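/- For $t>0$ let $w(x,t)=e^{-x^2-t/x^2}$, $x\in\mathbb R$, and for $n=0,1,2,\dots$ let $$D_n(t)=\det\Big(\int_{-\infty}^{\infty}x^{i+j}w(x,t)\,dx\Big)_{i,j=0}^{n-1},\qquad \sigma_n(t)=2t\frac{d}{dt}\ln D_n(t)$$ (with $D_0=1$); all the integrals converge, $D_n(t)>0$ and $\ln D_n$ is differentiable for $t>0$. (a) For every $n$, $\sigma_n$ is twice continuously differentiable on $(0,\infty)$ and, for all $t>0$, $$\Big\{\big[4\sigma_n-4(1+(-1)^n)t\sigma_n'+(-1)^nt(\sigma_n')^2\big]\big[4\sigma_n-8t\sigma_n'+8(1-(-1)^n)t\big]-(-1)^nt\big[2(1-(-1)^n)-\sigma_n'-2t\sigma_n''\big]^2\Big\}^2=256n^2\big[\sigma_n-2t\sigma_n'+2(1-(-1)^n)t\big]^3,$$ where $\sigma_n,\sigma_n',\sigma_n''$ are evaluated at $t$. (b) Suppose that for every $s>0$ the limit $\sigma(s)=\lim_{n\to\infty}\sigma_n(s/n^2)$ exists (that is, $n\to\infty$ and $t\to0$ with $s=n^2t$ fixed). Then $\sigma$ is twice continuously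 differentiable on $(0,\infty)$ and, for all $s>0$, $$4s^2\sigma''(s)^2+4s\,\sigma'(s)\sigma''(s)+8s\,\sigma'(s)^3-4\sigma(s)\sigma'(s)^2+\sigma'(s)^2=0.$$ -/

import Mathlib

open Filter Topology Set MeasureTheory

noncomputable section

/-- The singularly perturbed Gaussian weight `w(x,t) = exp(-x² - t/x²)`, used for `t > 0`.
The value at the single point `x = 0` does not affect any integral against Lebesgue measure. -/
def weight (x t : ℝ) : ℝ := Real.exp (-x ^ 2 - t / x ^ 2)

/-- The Hankel determinant `D_n(t) = det (∫ x^(i+j) w(x,t) dx)` with `0 ≤ i, j ≤ n-1`. -/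
def hankelDet (n : ℕ) (t : ℝ) : ℝ :=
  Matrix.det (Matrix.of fun i j : Fin n => ∫ x : ℝ, x ^ ((i : ℕ) + (j : ℕ)) * weight x t)

/-- `σ_n(t) = 2 t (d/dt) ln D_n(t)`. -/
def sigmaN (n : ℕ) (t : ℝ) : ℝ :=
  2 * t * deriv (fun u : ℝ => Real.log (hankelDet n u)) t

/-- The second order differential equation for `σ_n`, at the point `t`,
where `f`, `f'`, `f''` are the values of `σ_n`, `σ_n'`, `σ_n''` at `t`. -/
def SigmaODE (n : ℕ) (t f f' f'' : ℝ) : Prop :=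
  ((4 * f - 4 * (1 + (-1) ^ n) * t * f' + (-1) ^ n * t * f' ^ 2)
        * (4 * f - 8 * t * f' + 8 * (1 - (-1) ^ n) * t)
      - (-1) ^ n * t * (2 * (1 - (-1) ^ n) - f' - 2 * t * f'') ^ 2) ^ 2
    = 256 * (n : ℝ) ^ 2 * (f - 2 * t * f' + 2 * (1 - (-1) ^ n) * t) ^ 3

end

noncomputable section

open Polynomial

/-! Let `P_n` be the monic orthogonal polynomials, `h_n` their squared norms, `β_n = h_n / h_{n-1}`,
`a_n = 2β_n - n` and `R_n = a_{n+1} + a_n`. Integration by parts identifies `a_{n+1} h_n` and `R_n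
h_n` with `2t` times the integrals of `P_{n+1} P_n x⁻³ w` and `P_n² x⁻² w`. The nonlinear input is
`map_three_mul_orthoNorm`: expanding an even and an odd polynomial at the origin ties these
integrals together, and gives `β_{n+1} R_{n+1} R_n = 2t(-1)ⁿ a_{n+1}`. Two discrete consequences
follow, `recCoeff_mul_auxR_succ` and the first integral `auxA_sq`.

In `t`, a minimum argument gives `h_n' = -h_n R_n / (2t)`, so `σ_n = -∑_{j<n} R_j`. With `x = β_n
R_n` and `y = β_n R_{n-1}`, one then knows `x + y` from `σ_n'`, `y - x` from `a_n'`, `xy` from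
`a_n`, and `a_n²` from `σ_n` and `σ_n'`. The equation in (a) is `4xy = (x + y)² - (y - x)²`,
multiplied by `a_n²` and squared to remove the sign of `a_n`. Smoothness comes from Heine's formula,
which makes `D_n` a Laplace transform in `t` of a positive density, with moments satisfying `M_k' =
-M_{k+1}`.

For (b) only even sizes `N` are used. There `σ_N` is decreasing, so convergence at one point bounds
`M_1/M_0` locally uniformly; the chain of moments then bounds every `M_k/M_0`
(`locUnifBdd_div_of_chain`). Bounded second derivatives upgrade pointwise convergence to convergence
of derivatives (`exists_tendsto_deriv`), inductively for all the ratios. Thus the limit is smooth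
and the rescaled equation passes to the limit. Its right side carries a factor `1/N²`, so the
bracket squared on the left must vanish, which is the limiting equation. -/

/-! ### The weight and its integrals against powers of `1/x`. -/

lemma weight_eq_mul (x t : ℝ) : weight x t = Real.exp (-x ^ 2) * Real.exp (-(t * (1 / x ^ 2))) := by
  rw [weight, ← Real.exp_add]; congr 1; ring

lemma weight_pos (x t : ℝ) : 0 < weight x t := Real.exp_pos _

lemma weight_neg (x t : ℝ) : weight (-x) t = weight x t := by simp [weight]

lemma pow_mul_exp_neg_le {c u : ℝ} (hc : 0 < c) (hu : 0 ≤ u) (k : ℕ) :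
    u ^ k * Real.exp (-(c * u)) ≤ k.factorial / c ^ k := by
  have h := Real.pow_div_factorial_le_exp (x := c * u) (by positivity) k
  rw [Real.exp_neg, ← div_eq_mul_inv, div_le_div_iff₀ (Real.exp_pos _) (by positivity)]
  rw [div_le_iff₀ (by positivity), mul_pow] at h
  linarith

/-- The factor `e^{-t/x²}` absorbs any pole at the origin: `|y| ≤ 1 + y²` reduces to even powers.
This makes all functionals below finite. -/
lemma abs_one_div_pow_mul_exp_le {t : ℝ} (ht : 0 < t) (k : ℕ) (x : ℝ) :
    ‖1 / x ^ k * Real.exp (-(t * (1 / x ^ 2)))‖ ≤ 1 + k.factorial / t ^ k := by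
  have h0 : Real.exp (-(t * (1 / x ^ 2))) ≤ 1 := Real.exp_le_one_iff.2 (by
    have : 0 ≤ t * (1 / x ^ 2) := by positivity
    linarith)
  have h1 := pow_mul_exp_neg_le ht (u := 1 / x ^ 2) (by positivity) k
  have he := (Real.exp_pos (-(t * (1 / x ^ 2)))).le
  rw [norm_mul, Real.norm_of_nonneg he, Real.norm_eq_abs]
  have h2 : |1 / x ^ k| ≤ 1 + (1 / x ^ 2) ^ k := by
    have : (1 / x ^ 2) ^ k = |1 / x ^ k| ^ 2 := by rw [sq_abs]; ring
    rw [this]; nlinarith [sq_nonneg (|1 / x ^ k| - 1)]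
  calc _ ≤ (1 + (1 / x ^ 2) ^ k) * Real.exp (-(t * (1 / x ^ 2))) := by gcongr
    _ ≤ _ := by linarith

lemma integrable_eval_mul_exp_neg_sq (p : ℝ[X]) :
    Integrable fun x : ℝ => p.eval x * Real.exp (-x ^ 2) := by
  induction p using Polynomial.induction_on' with
  | add p q hp hq => 
    refine (hp.add hq).congr (Eventually.of_forall fun x => ?_)
    simp [add_mul]
  | monomial n a =>
    have h := integrable_rpow_mul_exp_neg_mul_sq (b := 1) one_pos (s := n)
      (by have : (0 : ℝ) ≤ n := n.cast_nonneg
          linarith)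
    have := h.const_mul a
    refine this.congr (Eventually.of_forall fun x => ?_)
    simp [mul_assoc]

lemma integrable_eval_div_pow_mul_weight {t : ℝ} (ht : 0 < t) (k : ℕ) (p : ℝ[X]) :
    Integrable fun x : ℝ => p.eval x / x ^ k * weight x t := by
  have h := (integrable_eval_mul_exp_neg_sq p).mul_bdd
    (g := fun x => 1 / x ^ k * Real.exp (-(t * (1 / x ^ 2)))) (c := 1 + k.factorial / t ^ k)
    (by apply Measurable.aestronglyMeasurable; fun_prop)
    (Eventually.of_forall (abs_one_div_pow_mul_exp_le ht k))
  refine h.congr (Eventually.of_forall fun x => ?_)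
  simp only [weight_eq_mul]; ring

lemma integrable_pow_mul_weight {t : ℝ} (ht : 0 < t) (k : ℕ) :
    Integrable fun x : ℝ => x ^ k * weight x t := by
  simpa using integrable_eval_div_pow_mul_weight ht 0 (X ^ k)

/-- The functional `p ↦ ∫ p(x) x⁻ᵏ w(x,t) dx` on polynomials. -/
def weightFunctional {t : ℝ} (ht : 0 < t) (k : ℕ) : ℝ[X] →ₗ[ℝ] ℝ where
  toFun p := ∫ x : ℝ, p.eval x / x ^ k * weight x t
  map_add' p q := by
    rw [← integral_add (integrable_eval_div_pow_mul_weight ht k p)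
      (integrable_eval_div_pow_mul_weight ht k q)]
    congr 1; ext x; simp; ring
  map_smul' c p := by
    rw [RingHom.id_apply, smul_eq_mul, ← integral_const_mul]
    congr 1; ext x; simp; ring

lemma weightFunctional_apply {t : ℝ} (ht : 0 < t) (k : ℕ) (p : ℝ[X]) :
    weightFunctional ht k p = ∫ x : ℝ, p.eval x / x ^ k * weight x t := rfl

lemma ae_ne_zero : ∀ᵐ x : ℝ, x ≠ 0 := by
  simp [ae_iff]

lemma weightFunctional_shift {t : ℝ} (ht : 0 < t) (k : ℕ) (p : ℝ[X]) :
    weightFunctional ht (k + 1) (X * p) = weightFunctional ht k p := by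
  simp only [weightFunctional_apply]
  refine integral_congr_ae (ae_ne_zero.mono fun x hx => ?_)
  simp only [eval_mul, eval_X]
  field_simp
  ring

lemma weightFunctional_comp_neg {t : ℝ} (ht : 0 < t) (k : ℕ) (p : ℝ[X]) :
    weightFunctional ht k (p.comp (-X)) = (-1) ^ k * weightFunctional ht k p := by
  simp only [weightFunctional_apply]
  rw [← integral_neg_eq_self (fun x : ℝ => p.eval x / x ^ k * weight x t), ← integral_const_mul]
  congr 1; ext x
  simp only [eval_comp, eval_neg, eval_X, weight_neg]
  have : ((-x) ^ k)⁻¹ = (-1) ^ k * (x ^ k)⁻¹ := by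
    rw [neg_pow, mul_inv]
    rcases neg_one_pow_eq_or ℝ k with h | h <;> simp [h]
  rw [div_eq_mul_inv, div_eq_mul_inv, this]
  have h2 : ((-1 : ℝ) ^ k) * (-1) ^ k = 1 := by rw [← mul_pow]; simp
  linear_combination (-(eval (-x) p * (x ^ k)⁻¹ * weight x t)) * h2

lemma weightFunctional_pos {t : ℝ} (ht : 0 < t) (k : ℕ) {p : ℝ[X]} (hp : p ≠ 0) :
    0 < weightFunctional ht (2 * k) (p ^ 2) := by
  rw [weightFunctional_apply, integral_pos_iff_support_of_nonneg _
    (integrable_eval_div_pow_mul_weight ht _ _)]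
  · have hfin : ({x | p.eval x = 0} ∪ {0} : Set ℝ).Finite :=
      (by simpa [Polynomial.IsRoot] using Polynomial.finite_setOfPred_isRoot hp :
        {x | p.eval x = 0}.Finite).union (finite_singleton _)
    have hsub : ({x | p.eval x = 0} ∪ {0} : Set ℝ)ᶜ ⊆
        Function.support fun x : ℝ => (p ^ 2).eval x / x ^ (2 * k) * weight x t := by
      intro x hx
      simp only [mem_compl_iff, mem_union, mem_ofPred_eq, mem_singleton_iff, not_or] at hx
      have := (weight_pos x t).ne'
      simp [hx.1, hx.2, this]
    refine lt_of_lt_of_le ?_ (measure_mono hsub)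
    rw [measure_compl hfin.measurableSet (by rw [hfin.measure_zero]; simp), hfin.measure_zero]
    simp
  · intro x
    have := (weight_pos x t).le
    simp only [eval_pow, pow_mul, Pi.zero_apply]
    positivity

/-- With `t / 0 = 0` the weight takes the value `1` at the origin, where its limit is `0`. The
redundant quotients `x² / x²` and `x⁴ / x⁴` replace the values at `0` by `0`, so that
differentiability holds on the whole line. -/
lemma hasDerivAt_eval_mul_weight {t : ℝ} (ht : 0 < t) (p : ℝ[X]) (x : ℝ) :
    HasDerivAt (fun x => x ^ 2 * p.eval x / x ^ 2 * weight x t)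
      ((derivative p - 2 * X * p).eval x * x ^ 4 / x ^ 4 * weight x t
        + 2 * t * (p.eval x / x ^ 3 * weight x t)) x := by
  rcases eq_or_ne x 0 with rfl | hx
  · simp only [ne_eq, OfNat.ofNat_ne_zero, not_false_eq_true, zero_pow, mul_zero, div_zero,
      zero_mul, add_zero]
    rw [hasDerivAt_iff_isLittleO_nhds_zero]
    simp only [zero_add, ne_eq, OfNat.ofNat_ne_zero, not_false_eq_true, zero_pow, zero_mul,
      div_zero, sub_zero, smul_zero]
    have h1 : (fun h : ℝ => h ^ 2 * p.eval h / h ^ 2 * weight h t) =O[𝓝 0]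
        fun h => p.eval h * h ^ 2 := by
      refine Asymptotics.IsBigO.of_bound (1 / t) (Eventually.of_forall fun h => ?_)
      rcases eq_or_ne h 0 with rfl | hh
      · simp
      have h2 := pow_mul_exp_neg_le ht (u := 1 / h ^ 2) (by positivity) 1
      have h3 : weight h t ≤ 1 / t * h ^ 2 := by
        have h4 : Real.exp (-(t * (1 / h ^ 2))) ≤ 1 / t * h ^ 2 := by
          simp only [pow_one, Nat.factorial_one, Nat.cast_one] at h2
          rw [div_mul_eq_mul_div, one_mul, div_le_iff₀ (by positivity)] at h2
          exact h2
        rw [weight_eq_mul]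
        calc _ ≤ 1 * Real.exp (-(t * (1 / h ^ 2))) := by
              gcongr; exact Real.exp_le_one_iff.2 (by nlinarith [sq_nonneg h])
          _ ≤ _ := by linarith
      have h5 : h ^ 2 * p.eval h / h ^ 2 = p.eval h := by field_simp
      rw [h5, norm_mul, norm_mul, Real.norm_of_nonneg (weight_pos h t).le,
        Real.norm_of_nonneg (sq_nonneg h)]
      calc _ ≤ ‖p.eval h‖ * (1 / t * h ^ 2) := by gcongr
        _ = _ := by ring
    refine h1.trans_isLittleO ?_
    have h6 : (fun h : ℝ => p.eval h * h) =o[𝓝 0] fun _ => (1 : ℝ) := by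
      rw [Asymptotics.isLittleO_one_iff]
      have : Continuous fun h : ℝ => p.eval h * h := by fun_prop
      simpa using this.tendsto 0
    have h7 := h6.mul_isBigO (Asymptotics.isBigO_refl (fun h : ℝ => h) (𝓝 0))
    refine h7.congr (fun h => by ring) (fun h => by ring)
  · have hx2 : x ^ 2 ≠ 0 := pow_ne_zero _ hx
    have hq : HasDerivAt (fun x : ℝ => -x ^ 2 - t / x ^ 2) (-(2 * x) + 2 * t / x ^ 3) x := by
      have h1 := ((hasDerivAt_pow 2 x).neg).sub ((hasDerivAt_const x t).div (hasDerivAt_pow 2 x) hx2)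
      refine HasDerivAt.congr_deriv h1 ?_
      field_simp
      norm_num
      ring
    have h := (p.hasDerivAt x).mul hq.exp
    have he : (fun x => x ^ 2 * p.eval x / x ^ 2 * weight x t) =ᶠ[𝓝 x]
        ((fun x => p.eval x) * fun x : ℝ => Real.exp (-x ^ 2 - t / x ^ 2)) := by
      filter_upwards [eventually_ne_nhds hx] with y hy
      simp only [weight, Pi.mul_apply]
      congr 1; field_simp
    refine (h.congr_of_eventuallyEq he).congr_deriv ?_
    simp only [weight, eval_sub, eval_mul, eval_X, eval_ofNat]
    field_simp
    ring

/-- The integral of `(p w)'` is zero, and `w' = (-2x + 2t/x³) w`. -/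
lemma weightFunctional_ibp {t : ℝ} (ht : 0 < t) (p : ℝ[X]) :
    weightFunctional ht 0 (derivative p)
      = 2 * weightFunctional ht 0 (X * p) - 2 * t * weightFunctional ht 3 p := by
  have hi : Integrable fun x : ℝ => (derivative p - 2 * X * p).eval x * x ^ 4 / x ^ 4 * weight x t := by
    refine (integrable_eval_div_pow_mul_weight ht 4 ((derivative p - 2 * X * p) * X ^ 4)).congr
      (Eventually.of_forall fun x => ?_)
    simp only [eval_mul (q := X ^ 4), eval_pow, eval_X]
  have h3 := (integrable_eval_div_pow_mul_weight ht 3 p).const_mul (2 * t)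
  have h0 := integral_eq_zero_of_hasDerivAt_of_integrable (hasDerivAt_eval_mul_weight ht p)
    (hi.add h3) (by
      refine (integrable_eval_div_pow_mul_weight ht 2 (X ^ 2 * p)).congr
        (Eventually.of_forall fun x => ?_)
      simp only [eval_mul, eval_pow, eval_X])
  have e : ∫ x : ℝ, (derivative p - 2 * X * p).eval x * x ^ 4 / x ^ 4 * weight x t
      = weightFunctional ht 0 (derivative p - 2 * X * p) := by
    rw [weightFunctional_apply]
    refine integral_congr_ae (ae_ne_zero.mono fun x hx => ?_)
    field_simp
  rw [integral_add hi h3, integral_const_mul, e, ← weightFunctional_apply ht, map_sub] at h0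
  have : weightFunctional ht 0 (2 * X * p) = 2 * weightFunctional ht 0 (X * p) := by
    rw [← smul_eq_mul (2 : ℝ), ← map_smul]; congr 1
    rw [smul_eq_C_mul, mul_assoc]; rfl
  rw [this] at h0
  linarith

/-! ### Differentiation of Laplace integrals. -/

/-- If `g e^{-tY}` is integrable for every `t > 0`, so is `g Yᵏ e^{-tY}`, and its integral can be
differentiated under the integral sign. -/
lemma laplace_hasDerivAt {Ω : Type*} [MeasurableSpace Ω] {μ : Measure Ω} {g Y : Ω → ℝ}
    (hg : Measurable g) (hY : Measurable Y) (hY0 : ∀ x, 0 ≤ Y x)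
    (hint : ∀ t, 0 < t → Integrable (fun x => g x * Real.exp (-(t * Y x))) μ)
    (k : ℕ) {t : ℝ} (ht : 0 < t) :
    Integrable (fun x => g x * Y x ^ k * Real.exp (-(t * Y x))) μ ∧
    HasDerivAt (fun t => ∫ x, g x * Y x ^ k * Real.exp (-(t * Y x)) ∂μ)
      (-∫ x, g x * Y x ^ (k + 1) * Real.exp (-(t * Y x)) ∂μ) t := by
  have key : ∀ (k : ℕ) (t : ℝ), 0 < t →
      Integrable (fun x => g x * Y x ^ k * Real.exp (-(t * Y x))) μ := by
    intro k t ht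
    -- Half of the exponent keeps `g` integrable, the other half bounds `Yᵏ`.
    have h := (hint (t / 2) (by positivity)).mul_bdd
      (g := fun x => Y x ^ k * Real.exp (-(t / 2 * Y x))) (c := k.factorial / (t / 2) ^ k)
      (by apply Measurable.aestronglyMeasurable; fun_prop)
      (Eventually.of_forall fun x => by
        rw [Real.norm_of_nonneg (by have := hY0 x; positivity)]
        exact pow_mul_exp_neg_le (by positivity) (hY0 x) k)
    refine h.congr (Eventually.of_forall fun x => ?_)
    have : Real.exp (-(t * Y x)) = Real.exp (-(t / 2 * Y x)) * Real.exp (-(t / 2 * Y x)) := by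
      rw [← Real.exp_add]; congr 1; ring
    simp only [this]; ring
  refine ⟨key k t ht, ?_⟩
  have h := hasDerivAt_integral_of_dominated_loc_of_deriv_le (μ := μ) (𝕜 := ℝ) (E := ℝ) (x₀ := t)
    (s := Ioi (t / 2)) (F := fun t x => g x * Y x ^ k * Real.exp (-(t * Y x)))
    (F' := fun t x => -(g x * Y x ^ (k + 1) * Real.exp (-(t * Y x))))
    (bound := fun x => ‖g x * Y x ^ (k + 1) * Real.exp (-(t / 2 * Y x))‖)
    (Ioi_mem_nhds (by linarith))
    (Eventually.of_forall fun s => by apply Measurable.aestronglyMeasurable; fun_prop)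
    (key k t ht) (by apply Measurable.aestronglyMeasurable; fun_prop)
    (Eventually.of_forall fun x s hs => by
      rw [norm_neg, norm_mul _ (Real.exp _), norm_mul _ (Real.exp _)]
      refine mul_le_mul_of_nonneg_left ?_ (norm_nonneg _)
      rw [Real.norm_of_nonneg (Real.exp_pos _).le, Real.norm_of_nonneg (Real.exp_pos _).le]
      refine Real.exp_le_exp.2 (neg_le_neg (mul_le_mul_of_nonneg_right (le_of_lt hs) (hY0 x))))
    (key (k + 1) (t / 2) (by positivity)).norm
    (Eventually.of_forall fun x s _ => by
      have h1 : HasDerivAt (fun s : ℝ => -(s * Y x)) (-(Y x)) s := by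
        simpa using (hasDerivAt_mul_const (x := s) (Y x)).fun_neg
      have h2 := h1.exp.const_mul (g x * Y x ^ k)
      refine h2.congr_deriv ?_
      ring)
  have h2 := h.2
  rw [integral_neg] at h2
  exact h2

/-! ### Orthogonal polynomials of an even functional. -/

/-- The algebraic properties of the functionals `p ↦ ∫ p(x) x⁻ᵏ w(x,t) dx`. -/
structure IsSingularGaussian (t : ℝ) (L : ℕ → ℝ[X] →ₗ[ℝ] ℝ) : Prop where
  shift : ∀ k p, L (k + 1) (X * p) = L k p
  comp_neg : ∀ k p, L k (p.comp (-X)) = (-1) ^ k * L k p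
  ibp : ∀ p, L 0 (derivative p) = 2 * L 0 (X * p) - 2 * t * L 3 p
  pos : ∀ k p, p ≠ 0 → 0 < L (2 * k) (p ^ 2)

lemma isSingularGaussian_weightFunctional {t : ℝ} (ht : 0 < t) :
    IsSingularGaussian t (weightFunctional ht) where
  shift := weightFunctional_shift ht
  comp_neg := weightFunctional_comp_neg ht
  ibp := weightFunctional_ibp ht
  pos k _ hp := weightFunctional_pos ht k hp

/-- The monic orthogonal polynomials of an even functional, by their three-term recurrence. -/
def orthoPoly (φ : ℝ[X] →ₗ[ℝ] ℝ) : ℕ → ℝ[X]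
  | 0 => 1
  | 1 => X
  | n + 2 => X * orthoPoly φ (n + 1)
      - C (φ (orthoPoly φ (n + 1) ^ 2) / φ (orthoPoly φ n ^ 2)) * orthoPoly φ n

/-- The squared norm of the `n`-th monic orthogonal polynomial. -/
def orthoNorm (φ : ℝ[X] →ₗ[ℝ] ℝ) (n : ℕ) : ℝ := φ (orthoPoly φ n ^ 2)

lemma orthoPoly_add_two (φ : ℝ[X] →ₗ[ℝ] ℝ) (n : ℕ) :
    orthoPoly φ (n + 2) = X * orthoPoly φ (n + 1)
      - C (orthoNorm φ (n + 1) / orthoNorm φ n) * orthoPoly φ n := by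
  rw [orthoPoly]; rfl

lemma orthoPoly_monic_natDegree (φ : ℝ[X] →ₗ[ℝ] ℝ) (n : ℕ) :
    (orthoPoly φ n).Monic ∧ (orthoPoly φ n).natDegree = n := by
  induction n using Nat.twoStepInduction with
  | zero => simp [orthoPoly]
  | one => simp [orthoPoly, monic_X]
  | more n h0 h1 =>
    have hm : (X * orthoPoly φ (n + 1)).Monic := monic_X.mul h1.1
    have hd : (X * orthoPoly φ (n + 1)).natDegree = n + 2 := by
      rw [natDegree_X_mul h1.1.ne_zero, h1.2]
    have hlt : (C (orthoNorm φ (n + 1) / orthoNorm φ n) * orthoPoly φ n).degree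
        < (X * orthoPoly φ (n + 1)).degree := by
      rw [← smul_eq_C_mul]
      refine lt_of_le_of_lt (degree_smul_le _ _) ?_
      rw [degree_eq_natDegree h0.1.ne_zero, degree_eq_natDegree hm.ne_zero, hd, h0.2]
      exact_mod_cast (by omega : n < n + 2)
    rw [orthoPoly_add_two]
    exact ⟨hm.sub_of_left hlt, by
      rw [natDegree, degree_sub_eq_left_of_degree_lt hlt, ← natDegree, hd]⟩

lemma orthoPoly_monic (φ : ℝ[X] →ₗ[ℝ] ℝ) (n : ℕ) : (orthoPoly φ n).Monic :=
  (orthoPoly_monic_natDegree φ n).1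

lemma natDegree_orthoPoly (φ : ℝ[X] →ₗ[ℝ] ℝ) (n : ℕ) : (orthoPoly φ n).natDegree = n :=
  (orthoPoly_monic_natDegree φ n).2

lemma coeff_orthoPoly_self (φ : ℝ[X] →ₗ[ℝ] ℝ) (n : ℕ) : (orthoPoly φ n).coeff n = 1 := by
  have := orthoPoly_monic φ n
  rwa [Monic, leadingCoeff, natDegree_orthoPoly] at this

lemma orthoPoly_comp_neg (φ : ℝ[X] →ₗ[ℝ] ℝ) (n : ℕ) :
    (orthoPoly φ n).comp (-X) = (-1) ^ n * orthoPoly φ n := by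
  induction n using Nat.twoStepInduction with
  | zero => simp [orthoPoly]
  | one => simp [orthoPoly]
  | more n h0 h1 =>
    rw [orthoPoly_add_two]
    simp only [sub_comp, mul_comp, X_comp, C_comp, h0, h1]
    ring

lemma coeff_eq_zero_of_comp_neg {p : ℝ[X]} {n k : ℕ} (hp : p.comp (-X) = (-1) ^ n * p)
    (h : Odd (n + k)) : p.coeff k = 0 := by
  have h1 : (p.comp (C (-1) * X)).coeff k = p.coeff k * (-1) ^ k := comp_C_mul_X_coeff
  have h2 : (C (-1) * X : ℝ[X]) = -X := by simp
  have h3 : ((-1) ^ n * p : ℝ[X]) = C ((-1) ^ n) * p := by simp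
  rw [h2, hp, h3, coeff_C_mul] at h1
  rcases Nat.even_or_odd n with hn | hn
  · have hk : Odd k := by rcases Nat.even_or_odd k with h' | h'
                          · exact absurd (hn.add h') (Nat.not_even_iff_odd.2 h)
                          · exact h'
    rw [hn.neg_one_pow, hk.neg_one_pow] at h1
    linarith
  · have hk : Even k := by rcases Nat.even_or_odd k with h' | h'
                           · exact h'
                           · exact absurd (hn.add_odd h') (Nat.not_even_iff_odd.2 h)
    rw [hn.neg_one_pow, hk.neg_one_pow] at h1
    linarith

lemma eq_C_add_X_sq_mul {p : ℝ[X]} (h : p.coeff 1 = 0) :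
    p = C (p.coeff 0) + X * (X * divX (divX p)) := by
  have h1 := divX_mul_X_add p
  have h2 := divX_mul_X_add (divX p)
  rw [coeff_divX, h, C_0, add_zero] at h2
  conv_lhs => rw [← h1, ← h2]
  ring

namespace IsSingularGaussian

variable {t : ℝ} {L : ℕ → ℝ[X] →ₗ[ℝ] ℝ}

lemma map_C_mul (k : ℕ) (c : ℝ) (p : ℝ[X]) : L k (C c * p) = c * L k p := by
  rw [← smul_eq_C_mul, map_smul, smul_eq_mul]

lemma orthoNorm_pos (hL : IsSingularGaussian t L) (n : ℕ) : 0 < orthoNorm (L 0) n :=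
  hL.pos 0 _ (orthoPoly_monic _ n).ne_zero

lemma map_mul_X_pow_eq_zero (hL : IsSingularGaussian t L) {p : ℝ[X]} {n m : ℕ}
    (hp : p.comp (-X) = (-1) ^ n * p) (h : Odd (n + m)) : L 0 (p * X ^ m) = 0 := by
  have h1 := hL.comp_neg 0 (p * X ^ m)
  have h2 : (p * X ^ m).comp (-X) = C (-1) * (p * X ^ m) := by
    rw [mul_comp, hp, X_pow_comp, neg_pow (X : ℝ[X]), mul_mul_mul_comm, ← pow_add, h.neg_one_pow]
    simp
  rw [h2, map_C_mul] at h1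
  simp only [pow_zero, one_mul] at h1
  linarith

lemma map_mul_eq_sum (p : ℝ[X]) {q : ℝ[X]} {n : ℕ} (hq : q.natDegree < n) :
    L 0 (p * q) = ∑ i ∈ Finset.range n, q.coeff i * L 0 (p * X ^ i) := by
  conv_lhs => rw [q.as_sum_range_C_mul_X_pow' hq, Finset.mul_sum, map_sum]
  exact Finset.sum_congr rfl fun i _ => by rw [mul_left_comm, map_C_mul]

/-- Strong induction along the recurrence: lower powers vanish by induction, the power `n` by the
choice of the recurrence coefficient, and the power `n + 1` by parity, which is why no diagonal term
is needed. -/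
lemma map_orthoPoly_mul_X_pow (hL : IsSingularGaussian t L) (n : ℕ) :
    (∀ k < n, L 0 (orthoPoly (L 0) n * X ^ k) = 0) ∧
      L 0 (orthoPoly (L 0) n * X ^ n) = orthoNorm (L 0) n := by
  induction n using Nat.strong_induction_on with
  | _ n ih =>
  have hA : ∀ k < n, L 0 (orthoPoly (L 0) n * X ^ k) = 0 := by
    intro k hk
    match n, ih, hk with
    | 1, _, hk =>
      exact hL.map_mul_X_pow_eq_zero (orthoPoly_comp_neg _ 1)
        (by rw [Nat.lt_one_iff.1 hk]; decide)
    | n + 2, ih, hk =>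
      have hodd : ∀ m : ℕ, Odd (m + (m + 1)) := fun m => ⟨m, by ring⟩
      have e : orthoPoly (L 0) (n + 2) * X ^ k = orthoPoly (L 0) (n + 1) * X ^ (k + 1)
          - C (orthoNorm (L 0) (n + 1) / orthoNorm (L 0) n) * (orthoPoly (L 0) n * X ^ k) := by
        rw [orthoPoly_add_two]; ring
      rw [e, map_sub, map_C_mul]
      rcases lt_trichotomy k n with h | h | h
      · rw [(ih (n + 1) (by omega)).1 _ (by omega), (ih n (by omega)).1 _ h]; ring
      · subst h
        rw [(ih (k + 1) (by omega)).2, (ih k (by omega)).2]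
        have := (hL.orthoNorm_pos k).ne'
        field_simp; ring
      · obtain rfl : k = n + 1 := by omega
        rw [hL.map_mul_X_pow_eq_zero (orthoPoly_comp_neg _ (n + 1)) (hodd (n + 1)),
          hL.map_mul_X_pow_eq_zero (orthoPoly_comp_neg _ n) (hodd n)]
        ring
  refine ⟨hA, ?_⟩
  rw [orthoNorm, sq, map_mul_eq_sum _ (Nat.lt_succ_of_le (natDegree_orthoPoly (L 0) n).le), Finset.sum_range_succ,
    coeff_orthoPoly_self, one_mul, Finset.sum_eq_zero, zero_add]
  intro i hi
  rw [hA i (Finset.mem_range.1 hi), mul_zero]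

lemma map_orthoPoly_mul (hL : IsSingularGaussian t L) {n : ℕ} {q : ℝ[X]} (hq : q.natDegree ≤ n) :
    L 0 (orthoPoly (L 0) n * q) = q.coeff n * orthoNorm (L 0) n := by
  obtain ⟨h1, h2⟩ := hL.map_orthoPoly_mul_X_pow n
  rw [map_mul_eq_sum _ (Nat.lt_succ_of_le hq), Finset.sum_range_succ, h2, Finset.sum_eq_zero, zero_add]
  intro i hi
  rw [h1 i (Finset.mem_range.1 hi), mul_zero]

lemma map_orthoPoly_mul_eq_zero (hL : IsSingularGaussian t L) {n : ℕ} {q : ℝ[X]}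
    (hq : q.natDegree < n) : L 0 (orthoPoly (L 0) n * q) = 0 := by
  rw [hL.map_orthoPoly_mul hq.le, coeff_eq_zero_of_natDegree_lt hq, zero_mul]

/-- Integrate `P_{n+1} P_n` by parts; orthogonality leaves only leading coefficients. -/
lemma map_three_succ (hL : IsSingularGaussian t L) (n : ℕ) :
    2 * t * L 3 (orthoPoly (L 0) (n + 1) * orthoPoly (L 0) n)
      = 2 * orthoNorm (L 0) (n + 1) - (n + 1) * orthoNorm (L 0) n := by
  have hd : ∀ m, (derivative (orthoPoly (L 0) m)).natDegree ≤ m - 1 := fun m =>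
    (natDegree_derivative_le _).trans_eq (by rw [natDegree_orthoPoly])
  have h := hL.ibp (orthoPoly (L 0) (n + 1) * orthoPoly (L 0) n)
  have e1 : L 0 (derivative (orthoPoly (L 0) (n + 1) * orthoPoly (L 0) n))
      = (n + 1) * orthoNorm (L 0) n := by
    rw [derivative_mul, map_add, mul_comm (derivative _),
      hL.map_orthoPoly_mul (n := n) (hd (n + 1)), coeff_derivative, coeff_orthoPoly_self,
      hL.map_orthoPoly_mul_eq_zero ((hd n).trans_lt (by omega))]
    ring
  have e2 : L 0 (X * (orthoPoly (L 0) (n + 1) * orthoPoly (L 0) n)) = orthoNorm (L 0) (n + 1) := by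
    rw [mul_left_comm, hL.map_orthoPoly_mul, coeff_X_mul, coeff_orthoPoly_self, one_mul]
    rw [natDegree_X_mul (orthoPoly_monic _ _).ne_zero, natDegree_orthoPoly]
  rw [e1, e2] at h
  linarith

lemma map_two_zero (hL : IsSingularGaussian t L) :
    L 2 (orthoPoly (L 0) 0 ^ 2) = L 3 (orthoPoly (L 0) 1 * orthoPoly (L 0) 0) := by
  rw [← hL.shift 2]; simp [orthoPoly]

lemma map_two_succ (hL : IsSingularGaussian t L) (n : ℕ) :
    L 2 (orthoPoly (L 0) (n + 1) ^ 2) = L 3 (orthoPoly (L 0) (n + 2) * orthoPoly (L 0) (n + 1))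
      + orthoNorm (L 0) (n + 1) / orthoNorm (L 0) n
        * L 3 (orthoPoly (L 0) (n + 1) * orthoPoly (L 0) n) := by
  rw [← hL.shift 2, ← map_C_mul, ← map_add, orthoPoly_add_two]
  congr 1; ring

/-- For `E` even and `O` odd, expanding at the origin links the functionals with `x⁻²`, `x⁻³`. -/
lemma map_three_mul_eq (hL : IsSingularGaussian t L) {E O : ℝ[X]}
    (hE : E.coeff 1 = 0) (hO0 : O.coeff 0 = 0) (hO2 : O.coeff 2 = 0)
    (h1 : L 0 (E * divX (divX (divX O))) = 0) (h2 : L 0 (E * divX (divX E)) = 0)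
    (h3 : L 0 (O * (X * divX (divX (divX O)))) = 0) :
    L 3 (E * O) * (L 0 (E * divX O) - L 0 (O * (X * divX (divX E))))
      = L 2 (E ^ 2) * L 2 (O ^ 2) := by
  have hO : O = X * divX O := by
    have := divX_mul_X_add O
    rw [hO0, C_0, add_zero, mul_comm] at this
    exact this.symm
  have hs := eq_C_add_X_sq_mul (p := divX O) (by rw [coeff_divX]; exact hO2)
  have hE' := eq_C_add_X_sq_mul hE
  generalize hsO : divX O = s at *
  generalize divX (divX s) = v at *
  generalize divX (divX E) = u at *
  generalize s.coeff 0 = s0 at *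
  generalize E.coeff 0 = e0 at *
  -- Write `O = x s`, `s = s0 + x² v`, `E = e0 + x² u`. The hypotheses kill the remainders, and both
  -- sides become `e0 s0 · L 2 E · L 0 s`.
  have a1 : L 3 (E * O) = s0 * L 2 E := by
    have : E * O = X * (C s0 * E + X * (X * (E * v))) := by rw [hO, hs]; ring
    rw [this, hL.shift, map_add, hL.shift, hL.shift, h1, map_C_mul, add_zero]
  have a2 : L 2 (E ^ 2) = e0 * L 2 E := by
    have : E ^ 2 = C e0 * E + X * (X * (E * u)) := by linear_combination E * hE'
    rw [this, map_add, hL.shift, hL.shift, h2, map_C_mul, add_zero]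
  have a3 : L 2 (O ^ 2) = s0 * L 0 s := by
    have : O ^ 2 = X * (X * (C s0 * s + O * (X * v))) := by
      have : s * s = C s0 * s + O * (X * v) := by
        rw [hO]
        linear_combination s * hs
      rw [← this, hO]; ring
    rw [this, hL.shift, hL.shift, map_add, h3, map_C_mul, add_zero]
  have a4 : L 0 (E * s) = e0 * L 0 s + L 0 (O * (X * u)) := by
    rw [← map_C_mul, ← map_add]
    congr 1
    conv_lhs => rw [hE']
    rw [hO]; ring
  rw [a1, a2, a3, a4]
  ring

/-- In `map_three_mul_eq` the even and odd roles are played by `P_n` and `P_{n+1}` according to the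
parity of `n`. Exactly one of the two terms in its bracket survives orthogonality, which produces
the sign `(-1)ⁿ`. -/
lemma map_three_mul_orthoNorm (hL : IsSingularGaussian t L) (n : ℕ) :
    L 3 (orthoPoly (L 0) (n + 1) * orthoPoly (L 0) n) * ((-1) ^ n * orthoNorm (L 0) n)
      = L 2 (orthoPoly (L 0) (n + 1) ^ 2) * L 2 (orthoPoly (L 0) n ^ 2) := by
  have hc : ∀ m k, Odd (m + k) → (orthoPoly (L 0) m).coeff k = 0 := fun m k h =>
    coeff_eq_zero_of_comp_neg (orthoPoly_comp_neg _ m) h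
  have hX : ∀ p : ℝ[X], (X * p).natDegree ≤ p.natDegree + 1 := fun p => by
    simpa [add_comm] using natDegree_mul_le (p := (X : ℝ[X])) (q := p)
  have h1 : ∀ m, (orthoPoly (L 0) m).coeff m = 1 := coeff_orthoPoly_self _
  set P := orthoPoly (L 0)
  have hd : ∀ m, (P m).natDegree = m := natDegree_orthoPoly _
  have hdX : ∀ m, (divX (P m)).natDegree = m - 1 := fun m => by
    rw [natDegree_divX_eq_natDegree_tsub_one, hd]
  have hdX2 : ∀ m, (divX (divX (P m))).natDegree = m - 1 - 1 := fun m => by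
    rw [natDegree_divX_eq_natDegree_tsub_one, hdX]
  have hdX3 : ∀ m, (divX (divX (divX (P m)))).natDegree = m - 1 - 1 - 1 := fun m => by
    rw [natDegree_divX_eq_natDegree_tsub_one, hdX2]
  have h0 : ∀ {m k}, m < k → (P m).coeff k = 0 := fun h =>
    coeff_eq_zero_of_natDegree_lt (by rw [hd]; exact h)
  rcases Nat.even_or_odd n with hn | hn
  · have h := hL.map_three_mul_eq (E := P n) (O := P (n + 1)) (hc _ _ hn.add_one)
      (hc _ _ (by simpa using hn.add_one)) (hc _ _ (by
        rw [add_assoc]; exact hn.add_odd (by decide)))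
      (by rw [hL.map_orthoPoly_mul (by rw [hdX3]; omega), coeff_divX, coeff_divX, coeff_divX,
            h0 (by omega), zero_mul])
      (by rw [hL.map_orthoPoly_mul (by rw [hdX2]; omega), coeff_divX, coeff_divX,
            h0 (by omega), zero_mul])
      (by rw [hL.map_orthoPoly_mul ((hX _).trans (by rw [hdX3]; omega)), coeff_X_mul, coeff_divX,
            coeff_divX, coeff_divX, h0 (by omega), zero_mul])
    rw [hL.map_orthoPoly_mul (by rw [hdX]; omega), coeff_divX, h1,
      hL.map_orthoPoly_mul ((hX _).trans (by rw [hdX2]; omega)), coeff_X_mul, coeff_divX,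
      coeff_divX, h0 (by omega)] at h
    rw [hn.neg_one_pow, mul_comm (P (n + 1)), mul_comm (L 2 _)]
    linarith
  · obtain ⟨m, rfl⟩ : ∃ m, n = m + 1 := ⟨n - 1, by have := hn.pos; omega⟩
    have h := hL.map_three_mul_eq (E := P (m + 1 + 1)) (O := P (m + 1))
      (hc _ _ (by rw [add_assoc (m + 1)]; exact hn.add_even (by decide)))
      (hc _ _ hn) (hc _ _ (hn.add_even (by decide)))
      (by rw [hL.map_orthoPoly_mul (by rw [hdX3]; omega), coeff_divX, coeff_divX, coeff_divX,
            h0 (by omega), zero_mul])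
      (by rw [hL.map_orthoPoly_mul (by rw [hdX2]; omega), coeff_divX, coeff_divX,
            h0 (by omega), zero_mul])
      (by rw [hL.map_orthoPoly_mul ((hX _).trans (by rw [hdX3]; omega)), coeff_X_mul, coeff_divX,
            coeff_divX, coeff_divX, h0 (by omega), zero_mul])
    rw [hL.map_orthoPoly_mul (by rw [hdX]; omega), coeff_divX, h0 (by omega),
      hL.map_orthoPoly_mul ((hX _).trans (by rw [hdX2]; omega)), coeff_X_mul, coeff_divX,
      coeff_divX, h1] at h
    rw [hn.neg_one_pow]
    linarith

end IsSingularGaussian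

/-! ### Hankel determinants and the discrete system for the recurrence coefficients. -/

/-- The coefficient matrix of the `P_i` is unitriangular and diagonalizes the moment matrix by
congruence. -/
lemma hankelDet_eq_prod {t : ℝ} (ht : 0 < t) (n : ℕ) :
    hankelDet n t = ∏ j : Fin n, orthoNorm (weightFunctional ht 0) j := by
  have hL := isSingularGaussian_weightFunctional ht
  set L := weightFunctional ht
  set A : Matrix (Fin n) (Fin n) ℝ := Matrix.of fun i j => (orthoPoly (L 0) i).coeff j
  set H : Matrix (Fin n) (Fin n) ℝ := Matrix.of fun i j : Fin n =>
    ∫ x : ℝ, x ^ ((i : ℕ) + (j : ℕ)) * weight x t with hH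
  have hA : A.det = 1 := by
    rw [Matrix.det_of_isLowerTriangular]
    · simp [A, coeff_orthoPoly_self]
    · intro i j hij
      exact coeff_eq_zero_of_natDegree_lt (by rw [natDegree_orthoPoly]; exact hij)
  have hHe : ∀ i j, H i j = L 0 (X ^ (j : ℕ) * X ^ (i : ℕ)) := fun i j => by
    rw [← pow_add]; simp [hH, L, weightFunctional_apply, add_comm]
  have hdeg : ∀ i : Fin n, (orthoPoly (L 0) i).natDegree < n := fun i => by
    rw [natDegree_orthoPoly]; exact i.2
  have hmul : A * H * A.transpose
      = Matrix.diagonal fun j : Fin n => orthoNorm (L 0) j := by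
    ext i j
    have e1 : (A * H * A.transpose) i j = L 0 (orthoPoly (L 0) i * orthoPoly (L 0) j) := by
      rw [IsSingularGaussian.map_mul_eq_sum _ (hdeg j), ← Fin.sum_univ_eq_sum_range
        (fun l => (orthoPoly (L 0) j).coeff l * L 0 (orthoPoly (L 0) i * X ^ l)), Matrix.mul_apply]
      refine Finset.sum_congr rfl fun l _ => ?_
      rw [mul_comm (orthoPoly (L 0) i), IsSingularGaussian.map_mul_eq_sum _ (hdeg i),
        ← Fin.sum_univ_eq_sum_range (fun k => (orthoPoly (L 0) i).coeff k * L 0 (X ^ (l : ℕ) * X ^ k)),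
        Matrix.mul_apply, mul_comm]
      congr 1
      exact Finset.sum_congr rfl fun k _ => by rw [hHe]; rfl
    rw [e1]
    rcases lt_trichotomy i j with h | h | h
    · rw [Matrix.diagonal_apply_ne _ h.ne, mul_comm]
      exact hL.map_orthoPoly_mul_eq_zero (by rw [natDegree_orthoPoly]; exact h)
    · subst h; rw [Matrix.diagonal_apply_eq, orthoNorm, sq]
    · rw [Matrix.diagonal_apply_ne _ h.ne']
      exact hL.map_orthoPoly_mul_eq_zero (by rw [natDegree_orthoPoly]; exact h)
  have hdet := congrArg Matrix.det hmul
  rw [Matrix.det_mul, Matrix.det_mul, Matrix.det_transpose, hA, Matrix.det_diagonal, one_mul, mul_one]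
    at hdet
  exact hdet

lemma hankelDet_pos {t : ℝ} (ht : 0 < t) (n : ℕ) : 0 < hankelDet n t := by
  rw [hankelDet_eq_prod ht]
  exact Finset.prod_pos fun j _ => (isSingularGaussian_weightFunctional ht).orthoNorm_pos j

/-- The ratio of consecutive Hankel determinants: the squared norm of the `n`-th monic
orthogonal polynomial. -/
def normRatio (n : ℕ) (t : ℝ) : ℝ := hankelDet (n + 1) t / hankelDet n t

/-- The recurrence coefficient `β_n`. -/
def recCoeff : ℕ → ℝ → ℝ
  | 0, _ => 0
  | n + 1, t => normRatio (n + 1) t / normRatio n t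

/-- `a_n = 2 β_n - n`. -/
def auxA (n : ℕ) (t : ℝ) : ℝ := 2 * recCoeff n t - n

/-- `R_n = a_{n+1} + a_n`. -/
def auxR (n : ℕ) (t : ℝ) : ℝ := auxA (n + 1) t + auxA n t

lemma normRatio_eq_orthoNorm {t : ℝ} (ht : 0 < t) (n : ℕ) :
    normRatio n t = orthoNorm (weightFunctional ht 0) n := by
  rw [normRatio, div_eq_iff (hankelDet_pos ht n).ne', hankelDet_eq_prod ht, hankelDet_eq_prod ht,
    Fin.prod_univ_castSucc, mul_comm]
  simp

lemma normRatio_pos {t : ℝ} (ht : 0 < t) (n : ℕ) : 0 < normRatio n t :=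
  div_pos (hankelDet_pos ht _) (hankelDet_pos ht _)

lemma auxA_succ_mul {t : ℝ} (ht : 0 < t) (n : ℕ) :
    auxA (n + 1) t * normRatio n t = 2 * t * weightFunctional ht 3
      (orthoPoly (weightFunctional ht 0) (n + 1) * orthoPoly (weightFunctional ht 0) n) := by
  rw [(isSingularGaussian_weightFunctional ht).map_three_succ, ← normRatio_eq_orthoNorm,
    ← normRatio_eq_orthoNorm, auxA, recCoeff]
  have := (normRatio_pos ht n).ne'
  push_cast
  field_simp

lemma auxR_mul {t : ℝ} (ht : 0 < t) (n : ℕ) :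
    auxR n t * normRatio n t = 2 * t * weightFunctional ht 2
      (orthoPoly (weightFunctional ht 0) n ^ 2) := by
  have hL := isSingularGaussian_weightFunctional ht
  cases n with
  | zero =>
    rw [hL.map_two_zero, ← auxA_succ_mul]
    simp [auxR, auxA, recCoeff]
  | succ n =>
    have h1 := auxA_succ_mul ht (n + 1)
    have h2 := auxA_succ_mul ht n
    have h3 := (normRatio_pos ht n).ne'
    rw [hL.map_two_succ, auxR, add_mul, h1, mul_add, ← normRatio_eq_orthoNorm,
      ← normRatio_eq_orthoNorm, mul_left_comm (2 * t), ← h2]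
    field_simp

lemma auxR_pos {t : ℝ} (ht : 0 < t) (n : ℕ) : 0 < auxR n t := by
  have h := (isSingularGaussian_weightFunctional ht).pos 1 _
    (orthoPoly_monic (weightFunctional ht 0) n).ne_zero
  rw [mul_one] at h
  have h2 : 0 < auxR n t * normRatio n t := by rw [auxR_mul ht]; positivity
  exact pos_of_mul_pos_left h2 (normRatio_pos ht n).le

lemma recCoeff_nonneg {t : ℝ} (ht : 0 < t) (n : ℕ) : 0 ≤ recCoeff n t := by
  cases n with
  | zero => exact le_rfl
  | succ n => exact (div_pos (normRatio_pos ht _) (normRatio_pos ht _)).le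

lemma recCoeff_mul_auxR_mul_auxR {t : ℝ} (ht : 0 < t) (n : ℕ) :
    recCoeff (n + 1) t * auxR (n + 1) t * auxR n t = 2 * t * (-1) ^ n * auxA (n + 1) t := by
  have hL := isSingularGaussian_weightFunctional ht
  have h := hL.map_three_mul_orthoNorm n
  have h1 := auxA_succ_mul ht n
  have h2 := auxR_mul ht n
  have h3 := auxR_mul ht (n + 1)
  rw [← normRatio_eq_orthoNorm] at h
  have p0 := normRatio_pos ht n
  have p1 := normRatio_pos ht (n + 1)
  have e : ((-1 : ℝ) ^ n) * (-1) ^ n = 1 := by rw [← mul_pow]; simp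
  rw [recCoeff, div_mul_eq_mul_div, div_mul_eq_mul_div, div_eq_iff p0.ne']
  refine mul_right_cancel₀ p0.ne' ?_
  linear_combination (auxR n t * normRatio n t) * h3 + 2 * t * weightFunctional ht 2
      (orthoPoly (weightFunctional ht 0) (n + 1) ^ 2) * h2 - 4 * t ^ 2 * h
      - 2 * t * (-1) ^ n * normRatio n t * h1

lemma recCoeff_mul_auxR_zero {t : ℝ} (ht : 0 < t) : recCoeff 1 t * auxR 1 t = 2 * t := by
  have h := recCoeff_mul_auxR_mul_auxR ht 0
  have h0 := (auxR_pos ht 0).ne'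
  have h1 : auxA 1 t = auxR 0 t := by simp [auxR, auxA, recCoeff]
  refine mul_right_cancel₀ h0 ?_
  simp only [zero_add] at h
  rw [h, h1]; ring

/-- Subtracting consecutive cases of `recCoeff_mul_auxR_mul_auxR` leaves a right side proportional
to `a_{n+2} + a_{n+1} = R_{n+1}`, which cancels since it is positive. At `n = 0` the truncated index
is harmless because `β_0 = 0`. -/
lemma recCoeff_mul_auxR_succ {t : ℝ} (ht : 0 < t) (n : ℕ) :
    recCoeff (n + 1) t * auxR (n + 1) t
      = recCoeff n t * auxR (n - 1) t + 2 * t * (-1) ^ n := by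
  cases n with
  | zero => rw [zero_add, recCoeff_mul_auxR_zero ht]; simp [recCoeff]
  | succ n =>
    have h1 := recCoeff_mul_auxR_mul_auxR ht (n + 1)
    have h0 := recCoeff_mul_auxR_mul_auxR ht n
    refine mul_right_cancel₀ (auxR_pos ht (n + 1)).ne' ?_
    have hR : auxR (n + 1) t = auxA (n + 1 + 1) t + auxA (n + 1) t := rfl
    rw [Nat.add_sub_cancel]
    linear_combination h1 - h0 - 2 * t * (-1) ^ (n + 1) * hR

/-- A telescoping sum: `a_{n+1}² - a_n² + R_n = 2 R_n (β_{n+1} - β_n)`, and `recCoeff_mul_auxR_succ`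
supplies the other increments. -/
lemma auxA_sq {t : ℝ} (ht : 0 < t) (n : ℕ) :
    auxA n t ^ 2 + 2 * t * (1 - (-1) ^ n) + ∑ j ∈ Finset.range n, auxR j t
      = 2 * (recCoeff n t * auxR n t + recCoeff n t * auxR (n - 1) t) := by
  induction n with
  | zero => simp [auxA, recCoeff]
  | succ n ih =>
    rw [Finset.sum_range_succ, Nat.add_sub_cancel]
    have h := recCoeff_mul_auxR_succ ht n
    have e1 : recCoeff (n + 1) t = (auxA (n + 1) t + (n + 1)) / 2 := by
      rw [auxA]; push_cast; ring
    have e0 : recCoeff n t = (auxA n t + n) / 2 := by rw [auxA]; ring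
    have e2 : auxR n t = auxA (n + 1) t + auxA n t := rfl
    rw [pow_succ]
    generalize auxR (n - 1) t = y at *
    generalize auxR (n + 1) t = z at *
    rw [e1, e0] at *
    rw [e2] at *
    linear_combination ih - 2 * h

/-! ### Heine's formula and smoothness in `t`. -/

lemma det_vandermonde_sq_mul_prod {n : ℕ} (f : ℝ → ℝ) (x : Fin n → ℝ) :
    (Matrix.vandermonde x).det ^ 2 * ∏ i, f (x i)
      = ∑ σ : Equiv.Perm (Fin n), ∑ τ : Equiv.Perm (Fin n),
        ((Equiv.Perm.sign σ : ℤ) : ℝ) * ((Equiv.Perm.sign τ : ℤ) : ℝ)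
          * ∏ i, (x i ^ ((σ i : ℕ) + (τ i : ℕ)) * f (x i)) := by
  rw [← Matrix.det_transpose, Matrix.det_apply', sq, Finset.sum_mul_sum, Finset.sum_mul]
  refine Finset.sum_congr rfl fun σ _ => ?_
  rw [Finset.sum_mul]
  refine Finset.sum_congr rfl fun τ _ => ?_
  simp only [Matrix.transpose_apply, Matrix.vandermonde_apply, pow_add, Finset.prod_mul_distrib]
  ring

/-- The density of the eigenvalues, without its factor `e^{-t ∑ 1/x_i²}`. -/
def heineDensity (n : ℕ) (x : Fin n → ℝ) : ℝ :=
  (Matrix.vandermonde x).det ^ 2 * (∏ i, Real.exp (-x i ^ 2)) / n.factorial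

/-- The linear statistic `∑ 1/x_i²`. -/
def invSqSum (n : ℕ) (x : Fin n → ℝ) : ℝ := ∑ i, 1 / x i ^ 2

/-- The integral `∫ Yᵏ e^{-tY}` over the eigenvalue density, with `Y = ∑ 1/x_i²`. -/
def heineMoment (n k : ℕ) (t : ℝ) : ℝ :=
  ∫ x : Fin n → ℝ, heineDensity n x * invSqSum n x ^ k * Real.exp (-(t * invSqSum n x))

lemma measurable_heineDensity (n : ℕ) : Measurable (heineDensity n) := by
  unfold heineDensity
  simp only [Matrix.det_vandermonde]
  fun_prop

lemma measurable_invSqSum (n : ℕ) : Measurable (invSqSum n) := by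
  unfold invSqSum; fun_prop

lemma heineDensity_nonneg (n : ℕ) (x : Fin n → ℝ) : 0 ≤ heineDensity n x := by
  unfold heineDensity; positivity

lemma invSqSum_nonneg (n : ℕ) (x : Fin n → ℝ) : 0 ≤ invSqSum n x := by
  unfold invSqSum; positivity

lemma heineDensity_mul_exp (n : ℕ) (t : ℝ) (x : Fin n → ℝ) :
    heineDensity n x * Real.exp (-(t * invSqSum n x))
      = (n.factorial : ℝ)⁻¹ * ((Matrix.vandermonde x).det ^ 2 * ∏ i, weight (x i) t) := by
  simp only [weight_eq_mul, Finset.prod_mul_distrib, heineDensity, invSqSum, Finset.mul_sum,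
    ← Finset.sum_neg_distrib, Real.exp_sum]
  ring

/-- After expanding both Vandermonde factors, each fixed `σ` contributes a moment determinant with
permuted columns; the two signs cancel, so all `n!` contributions are equal. -/
lemma integrable_det_vandermonde_sq {t : ℝ} (ht : 0 < t) (n : ℕ) :
    Integrable (fun x : Fin n → ℝ => (Matrix.vandermonde x).det ^ 2 * ∏ i, weight (x i) t) ∧
    ∫ x : Fin n → ℝ, (Matrix.vandermonde x).det ^ 2 * ∏ i, weight (x i) t
      = n.factorial * hankelDet n t := by
  have hi : ∀ σ τ : Equiv.Perm (Fin n), Integrable fun x : Fin n → ℝ =>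
      ((Equiv.Perm.sign σ : ℤ) : ℝ) * ((Equiv.Perm.sign τ : ℤ) : ℝ)
          * ∏ i, (x i ^ ((σ i : ℕ) + (τ i : ℕ)) * weight (x i) t) := fun σ τ =>
    (Integrable.fintype_prod (f := fun i y => y ^ ((σ i : ℕ) + (τ i : ℕ)) * weight y t)
      fun i => integrable_pow_mul_weight ht _).const_mul _
  have he := funext fun x : Fin n → ℝ => det_vandermonde_sq_mul_prod (fun y => weight y t) x
  simp only [he]
  refine ⟨integrable_finsetSum _ fun σ _ => integrable_finsetSum _ fun τ _ => hi σ τ, ?_⟩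
  rw [integral_finsetSum _ fun σ _ => integrable_finsetSum _ fun τ _ => hi σ τ]
  have hσ : ∀ σ : Equiv.Perm (Fin n), (∫ x : Fin n → ℝ, ∑ τ : Equiv.Perm (Fin n),
      ((Equiv.Perm.sign σ : ℤ) : ℝ) * ((Equiv.Perm.sign τ : ℤ) : ℝ)
        * ∏ i, (x i ^ ((σ i : ℕ) + (τ i : ℕ)) * weight (x i) t)) = hankelDet n t := by
    intro σ
    rw [integral_finsetSum _ fun τ _ => hi σ τ]
    have hp := Matrix.det_permute' σ (Matrix.of fun i j : Fin n =>
      ∫ x : ℝ, x ^ ((i : ℕ) + (j : ℕ)) * weight x t)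
    rw [Matrix.det_apply'] at hp
    have hs : ((Equiv.Perm.sign σ : ℤ) : ℝ) * ((Equiv.Perm.sign σ : ℤ) : ℝ) = 1 := by
      rw [← Int.cast_mul, ← Units.val_mul, Int.units_mul_self]; simp
    have h2 : ∀ τ : Equiv.Perm (Fin n), (∫ x : Fin n → ℝ,
        ((Equiv.Perm.sign σ : ℤ) : ℝ) * ((Equiv.Perm.sign τ : ℤ) : ℝ)
          * ∏ i, (x i ^ ((σ i : ℕ) + (τ i : ℕ)) * weight (x i) t))
        = ((Equiv.Perm.sign σ : ℤ) : ℝ) * (((Equiv.Perm.sign τ : ℤ) : ℝ)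
          * ∏ i, ((Matrix.of fun i j : Fin n =>
            ∫ x : ℝ, x ^ ((i : ℕ) + (j : ℕ)) * weight x t).submatrix id σ) (τ i) i) := by
      intro τ
      rw [integral_const_mul, mul_assoc]
      congr 2
      rw [integral_fintype_prod_volume_eq_prod
        (fun i y => y ^ ((σ i : ℕ) + (τ i : ℕ)) * weight y t)]
      refine Finset.prod_congr rfl fun i _ => ?_
      simp [add_comm]
    simp only [h2]
    rw [← Finset.mul_sum, hp, ← mul_assoc, hs, one_mul, hankelDet]
  simp only [hσ]
  simp [Fintype.card_perm]

lemma integrable_heineDensity_mul_exp {t : ℝ} (ht : 0 < t) (n : ℕ) :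
    Integrable fun x : Fin n → ℝ => heineDensity n x * Real.exp (-(t * invSqSum n x)) := by
  simp only [heineDensity_mul_exp]
  exact (integrable_det_vandermonde_sq ht n).1.const_mul _

/-- Heine's formula. -/
lemma heineMoment_zero {t : ℝ} (ht : 0 < t) (n : ℕ) : heineMoment n 0 t = hankelDet n t := by
  simp only [heineMoment, pow_zero, mul_one, heineDensity_mul_exp]
  rw [integral_const_mul, (integrable_det_vandermonde_sq ht n).2]
  have : (n.factorial : ℝ) ≠ 0 := by positivity
  field_simp

lemma heineMoment_nonneg (n k : ℕ) (t : ℝ) : 0 ≤ heineMoment n k t :=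
  integral_nonneg fun x => mul_nonneg (mul_nonneg (heineDensity_nonneg n x)
    (pow_nonneg (invSqSum_nonneg n x) k)) (Real.exp_pos _).le

lemma hasDerivAt_heineMoment {t : ℝ} (ht : 0 < t) (n k : ℕ) :
    HasDerivAt (heineMoment n k) (-heineMoment n (k + 1) t) t :=
  (laplace_hasDerivAt (measurable_heineDensity n) (measurable_invSqSum n) (invSqSum_nonneg n)
    (fun _ hs => integrable_heineDensity_mul_exp hs n) k ht).2

lemma contDiffOn_of_hasDerivAt_seq {f : ℕ → ℝ → ℝ} {s : Set ℝ} (hs : IsOpen s)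
    (h : ∀ k, ∀ t ∈ s, HasDerivAt (f k) (f (k + 1) t) t) (m k : ℕ) : ContDiffOn ℝ m (f k) s := by
  induction m generalizing k with
  | zero =>
    exact contDiffOn_zero.2 fun t ht => (h k t ht).continuousAt.continuousWithinAt
  | succ m ih =>
    push_cast
    rw [contDiffOn_succ_iff_deriv_of_isOpen hs]
    refine ⟨fun t ht => (h k t ht).differentiableAt.differentiableWithinAt, by simp, ?_⟩
    exact (ih (k + 1)).congr fun t ht => (h k t ht).deriv

lemma contDiffOn_heineMoment (n k m : ℕ) : ContDiffOn ℝ m (heineMoment n k) (Ioi 0) := by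
  -- The signs turn the moments into successive derivatives of one function.
  have h := contDiffOn_of_hasDerivAt_seq (f := fun k t => (-1) ^ k * heineMoment n k t)
    isOpen_Ioi (fun k t ht => by
      refine ((hasDerivAt_heineMoment ht n k).const_mul ((-1 : ℝ) ^ k)).congr_deriv ?_
      rw [pow_succ]; ring) m k
  refine ((contDiffOn_const (c := (-1 : ℝ) ^ k)).mul h).congr fun t _ => ?_
  rw [← mul_assoc, ← mul_pow]; simp

lemma hasDerivAt_hankelDet {t : ℝ} (ht : 0 < t) (n : ℕ) :
    HasDerivAt (hankelDet n) (-heineMoment n 1 t) t :=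
  (hasDerivAt_heineMoment ht n 0).congr_of_eventuallyEq <| by
    filter_upwards [Ioi_mem_nhds ht] with u hu using (heineMoment_zero hu n).symm

lemma sigmaN_eq {t : ℝ} (ht : 0 < t) (n : ℕ) :
    sigmaN n t = -(2 * t * (heineMoment n 1 t / heineMoment n 0 t)) := by
  rw [sigmaN, ((hasDerivAt_hankelDet ht n).log (hankelDet_pos ht n).ne').deriv,
    heineMoment_zero ht]
  ring

lemma contDiffOn_sigmaN (n : ℕ) : ContDiffOn ℝ 2 (sigmaN n) (Ioi 0) := by
  have h : ContDiffOn ℝ 2 (fun t : ℝ => -(2 * t * (heineMoment n 1 t / heineMoment n 0 t)))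
      (Ioi 0) := by
    refine ((contDiffOn_const.mul contDiffOn_id).mul
      ((contDiffOn_heineMoment n 1 2).div (contDiffOn_heineMoment n 0 2) fun t ht => ?_)).neg
    rw [heineMoment_zero ht]; exact (hankelDet_pos ht n).ne'
  exact h.congr fun t ht => sigmaN_eq ht n

/-! ### Derivatives in `t` and the equation for `σ_n`. -/

/-- The monic orthogonal polynomial minimizes the squared norm among monic polynomials. -/
lemma IsSingularGaussian.orthoNorm_le {t : ℝ} {L : ℕ → ℝ[X] →ₗ[ℝ] ℝ} (hL : IsSingularGaussian t L)
    {n : ℕ} {q : ℝ[X]} (hq : q.Monic) (hn : q.natDegree = n) :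
    orthoNorm (L 0) n ≤ L 0 (q ^ 2) := by
  have h1 : L 0 (orthoPoly (L 0) n * q) = orthoNorm (L 0) n := by
    rw [hL.map_orthoPoly_mul hn.le, ← hn, hq.coeff_natDegree, one_mul]
  have h2 : 0 ≤ L 0 ((q - orthoPoly (L 0) n) ^ 2) := by
    by_cases h : q - orthoPoly (L 0) n = 0
    · simp [h]
    · exact (hL.pos 0 _ h).le
  have h3 : q ^ 2 + orthoPoly (L 0) n ^ 2
      = (q - orthoPoly (L 0) n) ^ 2 + (orthoPoly (L 0) n * q + orthoPoly (L 0) n * q) := by ring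
  have h4 := congrArg (L 0) h3
  rw [map_add, map_add, map_add, h1] at h4
  rw [orthoNorm] at *
  linarith

lemma hasDerivAt_weightFunctional_sq {t : ℝ} (ht : 0 < t) (q : ℝ[X]) :
    HasDerivAt (fun u => ∫ x : ℝ, (q ^ 2).eval x * weight x u)
      (-weightFunctional ht 2 (q ^ 2)) t := by
  have h := (laplace_hasDerivAt (μ := (volume : Measure ℝ))
    (g := fun x => (q ^ 2).eval x * Real.exp (-x ^ 2)) (Y := fun x => 1 / x ^ 2)
    (by fun_prop) (by fun_prop) (fun x => by positivity)
    (fun s hs => by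
      refine (integrable_eval_div_pow_mul_weight hs 0 (q ^ 2)).congr
        (Eventually.of_forall fun x => ?_)
      simp only [weight_eq_mul, pow_zero, div_one]; ring) 0 ht).2
  have e : (fun u => ∫ x : ℝ, (q ^ 2).eval x * weight x u) = fun u => ∫ x : ℝ,
      (q ^ 2).eval x * Real.exp (-x ^ 2) * (1 / x ^ 2) ^ 0 * Real.exp (-(u * (1 / x ^ 2))) := by
    funext u
    congr 1; funext x
    rw [weight_eq_mul]; ring
  rw [e]
  refine h.congr_deriv ?_
  rw [weightFunctional_apply]
  congr 2; funext x
  rw [weight_eq_mul]; ring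

/-- Freeze `q = P_n` at the given `t`. Then `∫ q² w(·, u) - h_n(u)` is nonnegative and vanishes at
`u = t`, so its derivative there is zero. Only `h_n` has to be differentiable, not the polynomial
`P_n`, and Heine's formula provides that. -/
lemma hasDerivAt_normRatio {t : ℝ} (ht : 0 < t) (n : ℕ) :
    HasDerivAt (normRatio n) (-(normRatio n t * auxR n t / (2 * t))) t := by
  have h := (hasDerivAt_hankelDet ht (n + 1)).div (hasDerivAt_hankelDet ht n)
    (hankelDet_pos ht n).ne'
  set q := orthoPoly (weightFunctional ht 0) n
  refine h.congr_deriv ?_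
  have hmin : IsLocalMin (fun u => (∫ x : ℝ, (q ^ 2).eval x * weight x u) - normRatio n u) t := by
    have h0 : (∫ x : ℝ, (q ^ 2).eval x * weight x t) - normRatio n t = 0 := by
      rw [normRatio_eq_orthoNorm ht, orthoNorm, weightFunctional_apply]
      simp [q]
    filter_upwards [Ioi_mem_nhds ht] with u hu
    have hu : 0 < u := hu
    rw [h0, normRatio_eq_orthoNorm hu, sub_nonneg]
    refine ((isSingularGaussian_weightFunctional hu).orthoNorm_le
      (orthoPoly_monic _ n) (natDegree_orthoPoly (weightFunctional ht 0) n)).trans_eq ?_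
    rw [weightFunctional_apply]
    simp [q]
  have h2 := hmin.hasDerivAt_eq_zero ((hasDerivAt_weightFunctional_sq ht q).sub h)
  have h3 := auxR_mul ht n
  rw [mul_comm (normRatio n t), h3, mul_div_cancel_left₀ _ (by positivity)]
  linarith

lemma hasDerivAt_recCoeff {t : ℝ} (ht : 0 < t) (n : ℕ) :
    HasDerivAt (recCoeff n) (recCoeff n t * (auxR (n - 1) t - auxR n t) / (2 * t)) t := by
  cases n with
  | zero =>
    refine (hasDerivAt_const t (0 : ℝ)).congr_deriv ?_
    simp [recCoeff]
  | succ n =>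
    refine ((hasDerivAt_normRatio ht (n + 1)).div (hasDerivAt_normRatio ht n)
      (normRatio_pos ht n).ne').congr_deriv ?_
    have := (normRatio_pos ht n).ne'
    rw [recCoeff, Nat.add_sub_cancel]
    field_simp
    ring

lemma hasDerivAt_auxA {t : ℝ} (ht : 0 < t) (n : ℕ) :
    HasDerivAt (auxA n) ((recCoeff n t * auxR (n - 1) t - recCoeff n t * auxR n t) / t) t := by
  refine (((hasDerivAt_recCoeff ht n).const_mul 2).sub_const (n : ℝ)).congr_deriv ?_
  field_simp

lemma hasDerivAt_log_hankelDet {t : ℝ} (ht : 0 < t) (n : ℕ) :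
    HasDerivAt (fun u => Real.log (hankelDet n u))
      (-(∑ j ∈ Finset.range n, auxR j t) / (2 * t)) t := by
  induction n with
  | zero => simpa [hankelDet] using hasDerivAt_const t (0 : ℝ)
  | succ n ih =>
    have h := ih.add ((hasDerivAt_normRatio ht n).log (normRatio_pos ht n).ne')
    have he : (fun u => Real.log (hankelDet (n + 1) u)) =ᶠ[𝓝 t]
        (fun u => Real.log (hankelDet n u)) + fun u => Real.log (normRatio n u) := by
      filter_upwards [Ioi_mem_nhds ht] with u hu
      rw [Pi.add_apply, ← Real.log_mul (hankelDet_pos hu n).ne' (normRatio_pos hu n).ne', normRatio,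
        mul_div_cancel₀ _ (hankelDet_pos hu n).ne']
    refine (h.congr_of_eventuallyEq he).congr_deriv ?_
    have := (normRatio_pos ht n).ne'
    rw [Finset.sum_range_succ]
    field_simp
    ring

lemma sigmaN_eq_neg_sum {t : ℝ} (ht : 0 < t) (n : ℕ) :
    sigmaN n t = -∑ j ∈ Finset.range n, auxR j t := by
  rw [sigmaN, (hasDerivAt_log_hankelDet ht n).deriv]
  field_simp

lemma hasDerivAt_sigmaN {t : ℝ} (ht : 0 < t) (n : ℕ) :
    HasDerivAt (sigmaN n) (2 * (1 - (-1) ^ n)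
      - (recCoeff n t * auxR n t + recCoeff n t * auxR (n - 1) t) / t) t := by
  have he : ∀ n, sigmaN n =ᶠ[𝓝 t] fun u => -∑ j ∈ Finset.range n, auxR j u := fun n => by
    filter_upwards [Ioi_mem_nhds ht] with u hu using sigmaN_eq_neg_sum hu n
  refine HasDerivAt.congr_of_eventuallyEq ?_ (he n)
  induction n with
  | zero => simpa [recCoeff] using hasDerivAt_const t (0 : ℝ)
  | succ n ih =>
    -- Each new summand is `R_n = a_{n+1} + a_n`; its derivative telescopes through
    -- `recCoeff_mul_auxR_succ`.
    have h := ih.sub ((hasDerivAt_auxA ht (n + 1)).add (hasDerivAt_auxA ht n))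
    have h2 : (fun u => -∑ j ∈ Finset.range (n + 1), auxR j u)
        = (fun u => -∑ j ∈ Finset.range n, auxR j u) - (auxA (n + 1) + auxA n) := by
      funext u
      simp only [Finset.sum_range_succ, Pi.sub_apply, Pi.add_apply, auxR]; ring
    rw [h2]
    refine h.congr_deriv ?_
    have h3 := recCoeff_mul_auxR_succ ht n
    rw [Nat.add_sub_cancel, h3, pow_succ]
    field_simp
    ring

lemma auxA_sq_eq {t : ℝ} (ht : 0 < t) (n : ℕ) :
    auxA n t ^ 2 = sigmaN n t - 2 * t * deriv (sigmaN n) t + 2 * (1 - (-1) ^ n) * t := by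
  have h := auxA_sq ht n
  rw [sigmaN_eq_neg_sum ht, (hasDerivAt_sigmaN ht n).deriv]
  field_simp
  linarith

lemma differentiableAt_deriv_sigmaN {t : ℝ} (ht : 0 < t) (n : ℕ) :
    DifferentiableAt ℝ (deriv (sigmaN n)) t :=
  (((contDiffOn_succ_iff_deriv_of_isOpen (n := 1) isOpen_Ioi).1
    (contDiffOn_sigmaN n)).2.2.differentiableOn (by simp)).differentiableAt (Ioi_mem_nhds ht)

/-- The derivative of `auxA_sq_eq`. -/
lemma two_mul_auxA_mul_deriv {t : ℝ} (ht : 0 < t) (n : ℕ) :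
    2 * auxA n t * ((recCoeff n t * auxR (n - 1) t - recCoeff n t * auxR n t) / t)
      = 2 * (1 - (-1) ^ n) - deriv (sigmaN n) t - 2 * t * deriv (deriv (sigmaN n)) t := by
  have h1 := (hasDerivAt_auxA ht n).pow 2
  have h2 := (((hasDerivAt_sigmaN ht n).differentiableAt.hasDerivAt.sub
    (((hasDerivAt_id t).const_mul 2).mul (differentiableAt_deriv_sigmaN ht n).hasDerivAt)).add
      ((hasDerivAt_id t).const_mul (2 * (1 - (-1) ^ n))))
  have h3 := (h1.congr_of_eventuallyEq (by
    filter_upwards [Ioi_mem_nhds ht] with u hu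
    simpa using (auxA_sq_eq hu n).symm)).unique h2
  norm_num at h3
  linarith

lemma recCoeff_sq_mul {t : ℝ} (ht : 0 < t) (n : ℕ) :
    recCoeff n t * auxR n t * (recCoeff n t * auxR (n - 1) t)
      = -(t * (-1) ^ n * auxA n t * (auxA n t + n)) := by
  cases n with
  | zero => simp [recCoeff, auxA]
  | succ n =>
    have h := recCoeff_mul_auxR_mul_auxR ht n
    have h2 : recCoeff (n + 1) t = (auxA (n + 1) t + (n + 1 : ℕ)) / 2 := by rw [auxA]; ring
    rw [Nat.add_sub_cancel, mul_left_comm, ← mul_assoc, ← mul_assoc, mul_assoc, mul_assoc,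
      ← mul_assoc (recCoeff _ _) (auxR _ _), h]
    conv_lhs => rw [h2]
    rw [pow_succ]
    ring

lemma sigmaODE_sigmaN {t : ℝ} (ht : 0 < t) (n : ℕ) :
    SigmaODE n t (sigmaN n t) (deriv (sigmaN n) t) (deriv (deriv (sigmaN n)) t) := by
  have h1 := auxA_sq_eq ht n
  have h2 := two_mul_auxA_mul_deriv ht n
  have h3 := (hasDerivAt_sigmaN ht n).deriv
  have h4 := recCoeff_sq_mul ht n
  unfold SigmaODE
  have he := neg_one_pow_eq_or ℝ n
  generalize deriv (deriv (sigmaN n)) t = s2 at *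
  generalize deriv (sigmaN n) t = s1 at *
  generalize sigmaN n t = s at *
  generalize recCoeff n t * auxR n t = x at *
  generalize recCoeff n t * auxR (n - 1) t = y at *
  generalize auxA n t = a at *
  generalize (-1 : ℝ) ^ n = e at *
  -- This is `4xy = (x + y)² - (y - x)²`, with `x + y` and `xy` expressed through `s1` and `a`; the
  -- case split on `e` supplies `e² = 1`.
  have h5 : 4 * s - 4 * (1 + e) * t * s1 + e * t * s1 ^ 2 - e * t * ((y - x) / t) ^ 2
      = -(4 * a * n) := by
    refine mul_left_cancel₀ ht.ne' ?_
    have h6 : s = a ^ 2 + 2 * t * s1 - 2 * (1 - e) * t := by linarith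
    rw [h6, h3]
    rcases he with rfl | rfl
    · field_simp
      linear_combination 4 * h4
    · field_simp
      linear_combination (-4) * h4
  -- Multiplying by `4a²` turns the square of `(y - x)/t = a'` into that of `2aa'`, which `h2`
  -- expresses through `s1` and `s2`.
  have h7 : (4 * s - 4 * (1 + e) * t * s1 + e * t * s1 ^ 2) * (4 * s - 8 * t * s1 + 8 * (1 - e) * t)
      - e * t * (2 * (1 - e) - s1 - 2 * t * s2) ^ 2 = -(16 * a ^ 3 * n) := by
    rw [← h2]
    have h8 : 4 * s - 8 * t * s1 + 8 * (1 - e) * t = 4 * a ^ 2 := by linarith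
    rw [h8]
    linear_combination 4 * a ^ 2 * h5
  rw [h7, ← h1]
  ring

/-! ### Local bounds and convergence of derivatives. -/

/-- A sequence of functions that is uniformly bounded on each compact subset of `(0, ∞)`. -/
def LocUnifBdd (u : ℕ → ℝ → ℝ) : Prop :=
  ∀ a b : ℝ, 0 < a → ∃ C : ℝ, ∀ n, ∀ s ∈ Icc a b, |u n s| ≤ C

lemma LocUnifBdd.mul {u v : ℕ → ℝ → ℝ} (hu : LocUnifBdd u) (hv : LocUnifBdd v) :
    LocUnifBdd fun n s => u n s * v n s := fun a b ha => by
  obtain ⟨C, hC⟩ := hu a b ha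
  obtain ⟨D, hD⟩ := hv a b ha
  refine ⟨C * D, fun n s hs => ?_⟩
  rw [abs_mul]
  exact mul_le_mul (hC n s hs) (hD n s hs) (abs_nonneg _) ((abs_nonneg _).trans (hC n s hs))

lemma LocUnifBdd.add {u v : ℕ → ℝ → ℝ} (hu : LocUnifBdd u) (hv : LocUnifBdd v) :
    LocUnifBdd fun n s => u n s + v n s := fun a b ha => by
  obtain ⟨C, hC⟩ := hu a b ha
  obtain ⟨D, hD⟩ := hv a b ha
  exact ⟨C + D, fun n s hs => (abs_add_le _ _).trans (add_le_add (hC n s hs) (hD n s hs))⟩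

lemma LocUnifBdd.sub {u v : ℕ → ℝ → ℝ} (hu : LocUnifBdd u) (hv : LocUnifBdd v) :
    LocUnifBdd fun n s => u n s - v n s := fun a b ha => by
  obtain ⟨C, hC⟩ := hu a b ha
  obtain ⟨D, hD⟩ := hv a b ha
  exact ⟨C + D, fun n s hs => (abs_sub _ _).trans (add_le_add (hC n s hs) (hD n s hs))⟩

lemma abs_sub_sub_mul_le {u u1 u2 : ℝ → ℝ} {a b C : ℝ}
    (h1 : ∀ x ∈ Icc a b, HasDerivAt u (u1 x) x) (h2 : ∀ x ∈ Icc a b, HasDerivAt u1 (u2 x) x)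
    (hC : ∀ x ∈ Icc a b, |u2 x| ≤ C) {s r : ℝ} (hs : s ∈ Icc a b) (hr : r ∈ Icc a b) :
    |u r - u s - (r - s) * u1 s| ≤ C * (r - s) ^ 2 := by
  have hsub : uIcc s r ⊆ Icc a b := uIcc_subset_Icc hs hr
  have hb : ∀ x ∈ uIcc s r, ‖u1 x - u1 s‖ ≤ C * |r - s| := by
    intro x hx
    have := (convex_Icc a b).norm_image_sub_le_of_norm_hasDerivWithin_le
      (fun y hy => (h2 y hy).hasDerivWithinAt) hC hs (hsub hx)
    refine this.trans (mul_le_mul_of_nonneg_left (abs_sub_left_of_mem_uIcc hx)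
      ((abs_nonneg _).trans (hC s hs)))
  have h3 := (convex_uIcc s r).norm_image_sub_le_of_norm_hasDerivWithin_le
    (f := fun x => u x - x * u1 s) (f' := fun x => u1 x - u1 s)
    (fun y hy => ((h1 y (hsub hy)).sub (hasDerivAt_mul_const (u1 s))).hasDerivWithinAt) hb
    left_mem_uIcc right_mem_uIcc
  rw [Real.norm_eq_abs, Real.norm_eq_abs, mul_assoc, ← sq, sq_abs] at h3
  convert h3 using 2
  ring

/-- Pointwise convergence together with local bounds on the second derivatives gives convergence
of the derivatives. -/
lemma exists_tendsto_deriv {u u1 u2 : ℕ → ℝ → ℝ} {f : ℝ → ℝ}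
    (h1 : ∀ n s, 0 < s → HasDerivAt (u n) (u1 n s) s)
    (h2 : ∀ n s, 0 < s → HasDerivAt (u1 n) (u2 n s) s) (hb : LocUnifBdd u2)
    (hf : ∀ s, 0 < s → Tendsto (fun n => u n s) atTop (𝓝 (f s))) :
    ∃ g : ℝ → ℝ, ∀ s, 0 < s → Tendsto (fun n => u1 n s) atTop (𝓝 (g s)) ∧ HasDerivAt f (g s) s := by
  suffices h : ∀ s : ℝ, ∃ c : ℝ, 0 < s → Tendsto (fun n => u1 n s) atTop (𝓝 c) ∧ HasDerivAt f c s by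
    choose g hg using h
    exact ⟨g, hg⟩
  intro s
  by_cases hs : 0 < s
  swap
  · exact ⟨0, fun h => absurd h hs⟩
  obtain ⟨C, hC⟩ := hb (s / 2) (2 * s) (by positivity)
  have hC0 : 0 ≤ C := (abs_nonneg _).trans (hC 0 s ⟨by linarith, by linarith⟩)
  have key : ∀ n, ∀ r ∈ Icc (s / 2) (2 * s),
      |u n r - u n s - (r - s) * u1 n s| ≤ C * (r - s) ^ 2 := fun n r hr =>
    abs_sub_sub_mul_le (fun x hx => h1 n x (by linarith [hx.1]))
      (fun x hx => h2 n x (by linarith [hx.1])) (hC n) ⟨by linarith, by linarith⟩ hr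
  have hcau : CauchySeq fun n => u1 n s := by
    rw [Metric.cauchySeq_iff]
    intro ε hε
    -- The difference quotient with step `d` approximates `u1 n s` within `C d ≤ ε/4`; two such
    -- errors and an increment discrepancy below `d ε/4` total less than `d ε`. The bound `d ≤ s`
    -- keeps `s + d` in the interval.
    set d := min s (ε / (4 * (C + 1))) with hd
    have hd0 : 0 < d := lt_min hs (by positivity)
    have hds : d ≤ s := min_le_left _ _
    have hdC : C * d ≤ ε / 4 := by
      have h3 : d ≤ ε / (4 * (C + 1)) := min_le_right _ _
      rw [le_div_iff₀ (by positivity)] at h3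
      nlinarith
    have hc := ((hf (s + d) (by positivity)).sub (hf s hs)).cauchySeq
    rw [Metric.cauchySeq_iff] at hc
    obtain ⟨N, hN⟩ := hc (d * (ε / 4)) (by positivity)
    refine ⟨N, fun m hm n hn => ?_⟩
    have hmn := hN m hm n hn
    have km := key m (s + d) ⟨by linarith, by linarith⟩
    have kn := key n (s + d) ⟨by linarith, by linarith⟩
    rw [Real.dist_eq] at hmn ⊢
    rw [add_sub_cancel_left, abs_le] at km kn
    rw [abs_lt] at hmn ⊢
    have hCd : C * d ^ 2 ≤ d * (ε / 4) := by nlinarith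
    constructor
    · refine lt_of_mul_lt_mul_left (a := d) ?_ hd0.le
      nlinarith [mul_pos hd0 hε]
    · refine lt_of_mul_lt_mul_left (a := d) ?_ hd0.le
      nlinarith [mul_pos hd0 hε]
  obtain ⟨c, hc⟩ := cauchySeq_tendsto_of_complete hcau
  refine ⟨c, fun _ => ⟨hc, ?_⟩⟩
  have hlim : ∀ r ∈ Icc (s / 2) (2 * s), |f r - f s - (r - s) * c| ≤ C * (r - s) ^ 2 := fun r hr =>
    le_of_tendsto (((hf r (by linarith [hr.1])).sub (hf s hs)).sub (hc.const_mul (r - s))).abs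
      (Eventually.of_forall fun n => key n r hr)
  rw [hasDerivAt_iff_isLittleO]
  have hO : (fun r => f r - f s - (r - s) • c) =O[𝓝 s] fun r => (r - s) * (r - s) := by
    refine Asymptotics.IsBigO.of_bound C ?_
    filter_upwards [Icc_mem_nhds (by linarith : s / 2 < s) (by linarith : s < 2 * s)] with r hr
    rw [Real.norm_eq_abs, smul_eq_mul, ← sq, Real.norm_of_nonneg (sq_nonneg _)]
    exact hlim r hr
  refine hO.trans_isLittleO ?_
  have h0 : (fun r : ℝ => r - s) =o[𝓝 s] fun _ => (1 : ℝ) := by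
    rw [Asymptotics.isLittleO_one_iff]
    have : Continuous fun r : ℝ => r - s := by fun_prop
    simpa using this.tendsto s
  simpa using h0.mul_isBigO (Asymptotics.isBigO_refl (fun r : ℝ => r - s) (𝓝 s))

/-- Convergence of the first of the functions `ρ k = M k / M 0`, where `(M k)' = -M (k+1)`,
propagates to all of them. -/
lemma exists_limits_of_riccati_chain {ρ : ℕ → ℕ → ℝ → ℝ} {f : ℝ → ℝ}
    (hρ : ∀ k n s, 0 < s → HasDerivAt (ρ k n) (ρ k n s * ρ 1 n s - ρ (k + 1) n s) s)
    (hb : ∀ k, LocUnifBdd (ρ k))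
    (hf : ∀ s, 0 < s → Tendsto (fun n => ρ 1 n s) atTop (𝓝 (f s))) :
    ∃ g : ℕ → ℝ → ℝ, ∀ k s, 0 < s → Tendsto (fun n => ρ (k + 1) n s) atTop (𝓝 (g k s)) ∧
      HasDerivAt (g k) (g k s * g 0 s - g (k + 1) s) s := by
  -- The second derivative of `ρ k` is a polynomial in the `ρ j`, hence locally bounded.
  have hstep : ∀ (k : ℕ) (φ : ℝ → ℝ), (∀ s, 0 < s → Tendsto (fun n => ρ k n s) atTop (𝓝 (φ s))) →
      ∃ ψ : ℝ → ℝ, ∀ s, 0 < s →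
        Tendsto (fun n => ρ k n s * ρ 1 n s - ρ (k + 1) n s) atTop (𝓝 (ψ s)) ∧
        HasDerivAt φ (ψ s) s := fun k φ hφ =>
    exists_tendsto_deriv (hρ k)
      (fun n s hs => ((hρ k n s hs).mul (hρ 1 n s hs)).sub (hρ (k + 1) n s hs))
      ((((((hb k).mul (hb 1)).sub (hb (k + 1))).mul (hb 1)).add
        ((hb k).mul (((hb 1).mul (hb 1)).sub (hb (1 + 1))))).sub
          (((hb (k + 1)).mul (hb 1)).sub (hb (k + 1 + 1)))) hφ
  have hex : ∀ k : ℕ, ∃ φ : ℝ → ℝ, ∀ s, 0 < s →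
      Tendsto (fun n => ρ (k + 1) n s) atTop (𝓝 (φ s)) := by
    intro k
    induction k with
    | zero => exact ⟨f, hf⟩
    | succ k ih =>
      obtain ⟨φ, hφ⟩ := ih
      obtain ⟨ψ, hψ⟩ := hstep (k + 1) φ hφ
      -- The Riccati relation solved for the next ratio.
      refine ⟨fun s => φ s * f s - ψ s, fun s hs => ?_⟩
      have := ((hφ s hs).mul (hf s hs)).sub (hψ s hs).1
      simpa using this
  choose g hg using hex
  refine ⟨g, fun k s hs => ⟨hg k s hs, ?_⟩⟩
  obtain ⟨ψ, hψ⟩ := hstep (k + 1) (g k) (hg k)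
  have := tendsto_nhds_unique (hψ s hs).1 (((hg k s hs).mul (hg 0 s hs)).sub (hg (k + 1) s hs))
  rw [← this]
  exact (hψ s hs).2

lemma contDiffOn_of_riccati_chain {g : ℕ → ℝ → ℝ} {S : Set ℝ} (hS : IsOpen S)
    (hg : ∀ k, ∀ s ∈ S, HasDerivAt (g k) (g k s * g 0 s - g (k + 1) s) s) (m k : ℕ) :
    ContDiffOn ℝ m (g k) S := by
  induction m generalizing k with
  | zero => exact contDiffOn_zero.2 fun t ht => (hg k t ht).continuousAt.continuousWithinAt
  | succ m ih =>
    push_cast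
    rw [contDiffOn_succ_iff_deriv_of_isOpen hS]
    refine ⟨fun t ht => (hg k t ht).differentiableAt.differentiableWithinAt, by simp, ?_⟩
    exact (((ih k).mul (ih 0)).sub (ih (k + 1))).congr fun t ht => (hg k t ht).deriv

/-- For a chain `(M k)' = -M (k+1)` of nonnegative functions, local bounds for `M 1 / M 0` give
local bounds for every `M k / M 0`. -/
lemma locUnifBdd_div_of_chain {M : ℕ → ℕ → ℝ → ℝ} (h0 : ∀ n s, 0 < s → 0 < M 0 n s)
    (hM : ∀ k n s, 0 ≤ M k n s)
    (hd : ∀ k n s, 0 < s → HasDerivAt (M k n) (-M (k + 1) n s) s)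
    (hb : LocUnifBdd fun n s => M 1 n s / M 0 n s) (k : ℕ) :
    LocUnifBdd fun n s => M k n s / M 0 n s := by
  have hanti : ∀ k n, AntitoneOn (M k n) (Ioi 0) := fun k n =>
    antitoneOn_of_deriv_nonpos (convex_Ioi 0)
      (fun s hs => (hd k n s hs).continuousAt.continuousWithinAt)
      (fun s hs => (hd k n s (by simpa using hs)).differentiableAt.differentiableWithinAt)
      (fun s hs => by
        rw [(hd k n s (by simpa using hs)).deriv]
        exact neg_nonpos.2 (hM _ _ _))
  -- Mean value theorem on `[s - d, s]`, where `M (k+1)` is at least its value at `s`.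
  have hmvt : ∀ k n s d, 0 < d → d < s → M (k + 1) n s * d ≤ M k n (s - d) := by
    intro k n s d hd0 hds
    obtain ⟨ξ, hξ, he⟩ := exists_hasDerivAt_eq_slope (M k n) (fun s => -M (k + 1) n s)
      (show s - d < s by linarith)
      (fun x hx => (hd k n x (by linarith [hx.1])).continuousAt.continuousWithinAt)
      (fun x hx => hd k n x (by linarith [hx.1]))
    have h1 := hanti (k + 1) n (show ξ ∈ Ioi (0 : ℝ) from by
      show 0 < ξ; linarith [hξ.1]) (show s ∈ Ioi (0 : ℝ) from by show 0 < s; linarith) hξ.2.le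
    have h2 := hM k n s
    rw [sub_sub_cancel, eq_div_iff hd0.ne'] at he
    nlinarith
  -- A bound `M 1 ≤ B M 0` makes `e^{Bx} M 0` increasing, so a shift by `a/2` costs at most a factor
  -- `e^{Ba/2}`.
  have hgrow : ∀ a b : ℝ, 0 < a → ∃ B, 0 ≤ B ∧ ∀ n, ∀ s ∈ Icc a b,
      M 0 n (s - a / 2) ≤ B * M 0 n s := by
    intro a b ha
    obtain ⟨B, hB⟩ := hb (a / 2) b (by positivity)
    refine ⟨Real.exp (B * (a / 2)), (Real.exp_pos _).le, fun n s hs => ?_⟩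
    have hder : ∀ x, 0 < x → HasDerivAt (fun x => Real.exp (B * x) * M 0 n x)
        (Real.exp (B * x) * (B * M 0 n x - M 1 n x)) x := fun x hx => by
      refine ((((hasDerivAt_id x).const_mul B).exp).mul (hd 0 n x hx)).congr_deriv ?_
      simp; ring
    have hmono : MonotoneOn (fun x => Real.exp (B * x) * M 0 n x) (Icc (a / 2) b) :=
      monotoneOn_of_deriv_nonneg (convex_Icc _ _)
        (fun x hx => (hder x (by linarith [hx.1])).continuousAt.continuousWithinAt)
        (fun x hx => (hder x (by
          rw [interior_Icc] at hx; linarith [hx.1])).differentiableAt.differentiableWithinAt)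
        (fun x hx => by
          have hx := interior_subset hx
          have hx0 : 0 < x := by linarith [hx.1]
          rw [(hder x hx0).deriv]
          have h1 := (le_abs_self _).trans (hB n x hx)
          rw [div_le_iff₀ (h0 n x hx0)] at h1
          exact mul_nonneg (Real.exp_pos _).le (by linarith))
    have h2 := hmono (a := s - a / 2) (b := s) ⟨by linarith [hs.1], by linarith [hs.2]⟩
      ⟨by linarith [hs.1], hs.2⟩ (by linarith)
    simp only at h2
    have h3 : Real.exp (B * s) = Real.exp (B * (s - a / 2)) * Real.exp (B * (a / 2)) := by
      rw [← Real.exp_add]; congr 1; ring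
    rw [h3, mul_assoc] at h2
    exact le_of_mul_le_mul_left h2 (Real.exp_pos _)
  induction k with
  | zero =>
    refine fun a b ha => ⟨1, fun n s hs => ?_⟩
    change |M 0 n s / M 0 n s| ≤ 1
    rw [div_self (h0 n s (by linarith [hs.1])).ne', abs_one]
  | succ k ih =>
    intro a b ha
    obtain ⟨C, hC⟩ := ih (a / 2) b (by positivity)
    obtain ⟨B, hB0, hB⟩ := hgrow a b ha
    refine ⟨2 / a * (|C| * B), fun n s hs => ?_⟩
    have hs0 : 0 < s := by linarith [hs.1]
    have hs1 : 0 < s - a / 2 := by linarith [hs.1]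
    change |M (k + 1) n s / M 0 n s| ≤ 2 / a * (|C| * B)
    rw [abs_of_nonneg (div_nonneg (hM _ _ _) (hM _ _ _)), div_le_iff₀ (h0 n s hs0)]
    have h1 := hmvt k n s (a / 2) (by positivity) (by linarith)
    have h2 := (le_abs_self _).trans (hC n (s - a / 2) ⟨by linarith [hs.1], by linarith [hs.2]⟩)
    rw [div_le_iff₀ (h0 n _ hs1)] at h2
    have h3 := hB n s hs
    have h4 : C * M 0 n (s - a / 2) ≤ |C| * (B * M 0 n s) :=
      (mul_le_mul_of_nonneg_right (le_abs_self C) (hM _ _ _)).trans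
        (mul_le_mul_of_nonneg_left h3 (abs_nonneg C))
    have h5 : M (k + 1) n s * (a / 2) ≤ |C| * (B * M 0 n s) := h1.trans (h2.trans h4)
    rw [← le_div_iff₀ (by positivity)] at h5
    refine h5.trans_eq ?_
    field_simp

/-! ### The scaling limit along even sizes. -/

/-- The scaling factor `1/N²` for `N = 2n + 2`. -/
def evenScale (n : ℕ) : ℝ := 1 / ((2 * n + 2 : ℕ) : ℝ) ^ 2

lemma evenScale_pos (n : ℕ) : 0 < evenScale n := by unfold evenScale; positivity

lemma evenScale_mul (n : ℕ) : evenScale n * ((2 * n + 2 : ℕ) : ℝ) ^ 2 = 1 := by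
  unfold evenScale; field_simp

lemma tendsto_evenScale : Tendsto evenScale atTop (𝓝 0) := by
  have h : Tendsto (fun n : ℕ => 2 * n + 2) atTop atTop :=
    tendsto_atTop_mono (fun n => show n ≤ 2 * n + 2 by omega) tendsto_id
  have h2 : Tendsto (fun n : ℕ => ((2 * n + 2 : ℕ) : ℝ) ^ 2) atTop atTop :=
    (tendsto_pow_atTop two_ne_zero).comp (tendsto_natCast_atTop_atTop.comp h)
  exact (tendsto_const_nhds.div_atTop h2)

/-- The moments of Heine's density of even size `N = 2n + 2` under the scaling `t = s/N²`. -/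
def scaledMoment (k n : ℕ) (s : ℝ) : ℝ :=
  evenScale n ^ k * heineMoment (2 * n + 2) k (evenScale n * s)

lemma scaledMoment_nonneg (k n : ℕ) (s : ℝ) : 0 ≤ scaledMoment k n s :=
  mul_nonneg (pow_nonneg (evenScale_pos n).le k) (heineMoment_nonneg _ _ _)

lemma scaledMoment_zero_pos (n : ℕ) {s : ℝ} (hs : 0 < s) : 0 < scaledMoment 0 n s := by
  have h := mul_pos (evenScale_pos n) hs
  rw [scaledMoment, pow_zero, one_mul, heineMoment_zero h]
  exact hankelDet_pos h _

lemma hasDerivAt_scaledMoment (k n : ℕ) {s : ℝ} (hs : 0 < s) :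
    HasDerivAt (scaledMoment k n) (-scaledMoment (k + 1) n s) s := by
  have h := mul_pos (evenScale_pos n) hs
  refine (((hasDerivAt_heineMoment h (2 * n + 2) k).comp s
    (hasDerivAt_const_mul (x := s) (evenScale n))).const_mul (evenScale n ^ k)).congr_deriv ?_
  rw [scaledMoment]; ring

/-- The ratios of the scaled moments. -/
def momentRatio (k n : ℕ) (s : ℝ) : ℝ := scaledMoment k n s / scaledMoment 0 n s

lemma hasDerivAt_momentRatio (k n : ℕ) (s : ℝ) (hs : 0 < s) :
    HasDerivAt (momentRatio k n) (momentRatio k n s * momentRatio 1 n s - momentRatio (k + 1) n s)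
      s := by
  have h := (scaledMoment_zero_pos n hs).ne'
  refine ((hasDerivAt_scaledMoment k n hs).div (hasDerivAt_scaledMoment 0 n hs) h).congr_deriv ?_
  simp only [momentRatio]
  field_simp
  ring

lemma sigmaN_evenScale_mul (n : ℕ) {s : ℝ} (hs : 0 < s) :
    sigmaN (2 * n + 2) (evenScale n * s) = -(2 * s * momentRatio 1 n s) := by
  rw [sigmaN_eq (mul_pos (evenScale_pos n) hs), momentRatio, scaledMoment, scaledMoment]
  ring

/-- For even `n` the constant in `hasDerivAt_sigmaN` vanishes, leaving minus a nonnegative term. -/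
lemma antitoneOn_sigmaN_of_even {n : ℕ} (hn : Even n) : AntitoneOn (sigmaN n) (Ioi 0) := by
  refine antitoneOn_of_deriv_nonpos (convex_Ioi 0)
    (fun s hs => (hasDerivAt_sigmaN hs n).continuousAt.continuousWithinAt)
    (fun s hs => (hasDerivAt_sigmaN (by simpa using hs) n).differentiableAt.differentiableWithinAt)
    fun s hs => ?_
  have hs : 0 < s := by simpa using hs
  rw [(hasDerivAt_sigmaN hs n).deriv, hn.neg_one_pow]
  have := recCoeff_nonneg hs n
  have := (auxR_pos hs n).le
  have := (auxR_pos hs (n - 1)).le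
  have : 0 ≤ (recCoeff n s * auxR n s + recCoeff n s * auxR (n - 1) s) / s := by positivity
  linarith

/-- Convergence at the right endpoint `b` bounds `σ_N` below there, and monotonicity carries this
bound to the left; the ratio is `-σ_N / (2s)`. -/
lemma locUnifBdd_momentRatio_one {σ : ℝ → ℝ}
    (hσ : ∀ s, 0 < s → Tendsto (fun n => sigmaN (2 * n + 2) (evenScale n * s)) atTop (𝓝 (σ s))) :
    LocUnifBdd (momentRatio 1) := by
  intro a b ha
  by_cases hab : a ≤ b
  swap
  · exact ⟨0, fun n s hs => absurd (hs.1.trans hs.2) hab⟩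
  have hb : 0 < b := ha.trans_le hab
  obtain ⟨C, hC⟩ := (hσ b hb).bddBelow_range
  refine ⟨-C / (2 * a), fun n s hs => ?_⟩
  have hs0 : 0 < s := ha.trans_le hs.1
  have hc := evenScale_pos n
  have h1 : 0 ≤ momentRatio 1 n s := div_nonneg (scaledMoment_nonneg _ _ _) (scaledMoment_nonneg _ _ _)
  have h2 := antitoneOn_sigmaN_of_even (n := 2 * n + 2) (by simp [parity_simps])
    (show evenScale n * s ∈ Ioi (0 : ℝ) from mul_pos hc hs0)
    (show evenScale n * b ∈ Ioi (0 : ℝ) from mul_pos hc hb)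
    (mul_le_mul_of_nonneg_left hs.2 hc.le)
  have h3 : C ≤ sigmaN (2 * n + 2) (evenScale n * b) := hC ⟨n, rfl⟩
  have h4 := h3.trans h2
  rw [sigmaN_evenScale_mul n hs0] at h4
  rw [abs_of_nonneg h1, le_div_iff₀ (by positivity)]
  nlinarith [hs.1]

/-- The equation of `σ_n` for even `n` in the variable `s = n² t`. -/
lemma sigmaODE_scaled (n : ℕ) {s : ℝ} (hs : 0 < s) {S S1 S2 : ℝ → ℝ}
    (hS : ∀ r, 0 < r → sigmaN (2 * n + 2) (evenScale n * r) = S r)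
    (h1 : ∀ r, 0 < r → HasDerivAt S (S1 r) r) (h2 : ∀ r, 0 < r → HasDerivAt S1 (S2 r) r) :
    (((4 * S s - 8 * s * S1 s) * evenScale n + s * S1 s ^ 2) * (4 * S s - 8 * s * S1 s)
      - s * (S1 s + 2 * s * S2 s) ^ 2) ^ 2 = 256 * evenScale n * (S s - 2 * s * S1 s) ^ 3 := by
  set c := evenScale n with hc
  set N := 2 * n + 2 with hN
  have hc0 : 0 < c := evenScale_pos n
  have d1 : ∀ r, 0 < r → deriv (sigmaN N) (c * r) * c = S1 r := fun r hr => by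
    have h := (hasDerivAt_sigmaN (mul_pos hc0 hr) N).differentiableAt.hasDerivAt.comp r
      (hasDerivAt_const_mul (x := r) c)
    refine h.unique ((h1 r hr).congr_of_eventuallyEq ?_)
    filter_upwards [Ioi_mem_nhds hr] with u hu using hS u hu
  have d2 : deriv (deriv (sigmaN N)) (c * s) * c * c = S2 s := by
    have h := ((differentiableAt_deriv_sigmaN (mul_pos hc0 hs) N).hasDerivAt.comp s
      (hasDerivAt_const_mul (x := s) c)).mul_const c
    refine h.unique ((h2 s hs).congr_of_eventuallyEq ?_)
    filter_upwards [Ioi_mem_nhds hs] with u hu using d1 u hu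
  have hode := sigmaODE_sigmaN (mul_pos hc0 hs) N
  unfold SigmaODE at hode
  have hev : Even N := by simp [hN, parity_simps]
  have hcN : c * (N : ℝ) ^ 2 = 1 := evenScale_mul n
  rw [hev.neg_one_pow, hS s hs] at hode
  rw [← d1 s hs, ← d2]
  generalize deriv (deriv (sigmaN N)) (c * s) = p2 at *
  generalize deriv (sigmaN N) (c * s) = p1 at *
  -- At `t = cs` the factors `1/c` from the chain rule are cleared by `c²`, and `c N² = 1` turns `c²
  -- N²` into `c`.
  linear_combination c ^ 2 * hode + 256 * c * (S s - 2 * (c * s) * p1) ^ 3 * hcN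

lemma limit_sigma {σ : ℝ → ℝ}
    (hσ : ∀ s, 0 < s → Tendsto (fun n => sigmaN (2 * n + 2) (evenScale n * s)) atTop (𝓝 (σ s))) :
    ContDiffOn ℝ 2 σ (Ioi 0) ∧
      ∀ s : ℝ, 0 < s →
        4 * s ^ 2 * (deriv (deriv σ) s) ^ 2 + 4 * s * deriv σ s * deriv (deriv σ) s
          + 8 * s * (deriv σ s) ^ 3 - 4 * σ s * (deriv σ s) ^ 2 + (deriv σ s) ^ 2 = 0 := by
  have hρ1 : ∀ s, 0 < s → Tendsto (fun n => momentRatio 1 n s) atTop (𝓝 (-σ s / (2 * s))) := by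
    intro s hs
    refine ((hσ s hs).neg.div_const (2 * s)).congr fun n => ?_
    rw [sigmaN_evenScale_mul n hs]
    field_simp
  obtain ⟨g, hg⟩ := exists_limits_of_riccati_chain hasDerivAt_momentRatio
    (locUnifBdd_div_of_chain (fun n s => scaledMoment_zero_pos n) scaledMoment_nonneg
      (fun k n s hs => hasDerivAt_scaledMoment k n hs) (locUnifBdd_momentRatio_one hσ)) hρ1
  have hσg : ∀ s, 0 < s → σ s = -(2 * s * g 0 s) := fun s hs => by
    rw [tendsto_nhds_unique (hg 0 s hs).1 (hρ1 s hs)]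
    field_simp
  have hC : ContDiffOn ℝ 2 σ (Ioi 0) := by
    refine ContDiffOn.congr ?_ hσg
    exact ((contDiffOn_const.mul contDiffOn_id).mul
      (contDiffOn_of_riccati_chain isOpen_Ioi (fun k s hs => (hg k s hs).2) 2 0)).neg
  refine ⟨hC, fun s hs => ?_⟩
  -- first and second derivatives of `-2 s ρ` along a Riccati chain `ρ' = ρ² - ρ₂`
  have hd1 : ∀ {ρ ρ2 : ℝ → ℝ} {r : ℝ}, HasDerivAt ρ (ρ r * ρ r - ρ2 r) r →
      HasDerivAt (fun r => -(2 * r * ρ r)) (-(2 * ρ r) - 2 * r * (ρ r * ρ r - ρ2 r)) r := by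
    intro ρ ρ2 r h
    refine (((hasDerivAt_const_mul (x := r) (2 : ℝ)).mul h).neg).congr_deriv ?_
    ring
  have hd2 : ∀ {ρ ρ2 ρ3 : ℝ → ℝ} {r : ℝ}, HasDerivAt ρ (ρ r * ρ r - ρ2 r) r →
      HasDerivAt ρ2 (ρ2 r * ρ r - ρ3 r) r →
      HasDerivAt (fun r => -(2 * ρ r) - 2 * r * (ρ r * ρ r - ρ2 r))
        (-(4 * (ρ r * ρ r - ρ2 r)) - 2 * r * (2 * ρ r * (ρ r * ρ r - ρ2 r)
          - (ρ2 r * ρ r - ρ3 r))) r := by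
    intro ρ ρ2 ρ3 r h h2
    refine ((h.const_mul 2).neg.sub ((hasDerivAt_const_mul (x := r) (2 : ℝ)).mul
      ((h.mul h).sub h2))).congr_deriv ?_
    simp only [Pi.mul_apply, Pi.sub_apply]
    ring
  have e1 : ∀ r, 0 < r → deriv σ r = -(2 * g 0 r) - 2 * r * (g 0 r * g 0 r - g 1 r) := by
    intro r hr
    refine ((hd1 (hg 0 r hr).2).congr_of_eventuallyEq ?_).deriv
    filter_upwards [Ioi_mem_nhds hr] with u hu using hσg u hu
  have e2 : deriv (deriv σ) s = -(4 * (g 0 s * g 0 s - g 1 s)) - 2 * s *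
      (2 * g 0 s * (g 0 s * g 0 s - g 1 s) - (g 1 s * g 0 s - g 2 s)) := by
    refine ((hd2 (hg 0 s hs).2 (hg 1 s hs).2).congr_of_eventuallyEq ?_).deriv
    filter_upwards [Ioi_mem_nhds hs] with u hu using e1 u hu
  have t0 := (hg 0 s hs).1
  have t1 := (hg 1 s hs).1
  have t2 := (hg 2 s hs).1
  have lS := hσ s hs
  have lS1 : Tendsto (fun n => -(2 * momentRatio 1 n s)
      - 2 * s * (momentRatio 1 n s * momentRatio 1 n s - momentRatio 2 n s)) atTop
      (𝓝 (deriv σ s)) := by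
    rw [e1 s hs]
    exact (t0.const_mul 2).neg.sub (((t0.mul t0).sub t1).const_mul (2 * s))
  have lS2 : Tendsto (fun n => -(4 * (momentRatio 1 n s * momentRatio 1 n s - momentRatio 2 n s))
      - 2 * s * (2 * momentRatio 1 n s *
        (momentRatio 1 n s * momentRatio 1 n s - momentRatio 2 n s)
        - (momentRatio 2 n s * momentRatio 1 n s - momentRatio 3 n s))) atTop
      (𝓝 (deriv (deriv σ) s)) := by
    rw [e2]
    exact (((t0.mul t0).sub t1).const_mul 4).neg.sub
      ((((t0.const_mul 2).mul ((t0.mul t0).sub t1)).sub ((t1.mul t0).sub t2)).const_mul (2 * s))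
  have hode := fun n => sigmaODE_scaled n hs (fun r hr => sigmaN_evenScale_mul n hr)
    (fun r hr => hd1 (hasDerivAt_momentRatio 1 n r hr))
    (fun r hr => hd2 (hasDerivAt_momentRatio 1 n r hr) (hasDerivAt_momentRatio 2 n r hr))
  simp only [← sigmaN_evenScale_mul _ hs] at hode
  have hQ := (lS.const_mul 4).sub (lS1.const_mul (8 * s))
  have l1 := (((((hQ.mul tendsto_evenScale).add ((lS1.pow 2).const_mul s)).mul hQ).sub
    (((lS1.add (lS2.const_mul (2 * s))).pow 2).const_mul s)).pow 2)
  have l2 := (tendsto_evenScale.const_mul 256).mul ((lS.sub (lS1.const_mul (2 * s))).pow 3)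
  -- The right side tends to `0` with the scale, so the limit of the squared bracket is `0`; the
  -- bracket itself is `-s` times the desired expression.
  have h := tendsto_nhds_unique l1 (l2.congr fun n => (hode n).symm)
  rw [mul_zero, mul_zero, zero_mul, zero_add, sq_eq_zero_iff] at h
  refine mul_left_cancel₀ hs.ne' ?_
  linear_combination -h

end

theorem mainTheorem2 :
    (∀ n : ℕ,
      (∀ t : ℝ, 0 < t →
        (∀ k : ℕ, Integrable (fun x : ℝ => x ^ k * weight x t)) ∧
        0 < hankelDet n t ∧
        DifferentiableAt ℝ (fun u : ℝ => Real.log (hankelDet n u)) t) ∧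
      ContDiffOn ℝ 2 (sigmaN n) (Ioi 0) ∧
      ∀ t : ℝ, 0 < t →
        SigmaODE n t (sigmaN n t) (deriv (sigmaN n) t) (deriv (deriv (sigmaN n)) t)) ∧
    (∀ σ : ℝ → ℝ,
      (∀ s : ℝ, 0 < s →
        Tendsto (fun n : ℕ => sigmaN n (s / (n : ℝ) ^ 2)) atTop (𝓝 (σ s))) →
      ContDiffOn ℝ 2 σ (Ioi 0) ∧
      ∀ s : ℝ, 0 < s →
        4 * s ^ 2 * (deriv (deriv σ) s) ^ 2 + 4 * s * deriv σ s * deriv (deriv σ) s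
          + 8 * s * (deriv σ s) ^ 3 - 4 * σ s * (deriv σ s) ^ 2 + (deriv σ s) ^ 2 = 0) := by
  refine ⟨fun n => ⟨fun t ht => ⟨integrable_pow_mul_weight ht, hankelDet_pos ht n,
    (hasDerivAt_log_hankelDet ht n).differentiableAt⟩, contDiffOn_sigmaN n,
    fun t ht => sigmaODE_sigmaN ht n⟩, fun σ hσ => limit_sigma fun s hs => ?_⟩
  have h : Tendsto (fun n : ℕ => 2 * n + 2) atTop atTop :=
    tendsto_atTop_mono (fun n => show n ≤ 2 * n + 2 by omega) tendsto_id
  refine ((hσ s hs).comp h).congr fun n => ?_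
  simp only [Function.comp_apply, evenScale]
  congr 1; ring
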